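/- Let $\theta\in[0,1)$ be either $0$ or irrational. If $\theta$ is irrational, assume that its Diophantine exponent $\gamma$ is finite, where $\gamma$ is the infimum of the real $g$ for which $|\theta-p/q|\le q^{-g}$ holds for only finitely many pairs of integers $(p,q)$ with $q\ge 1$; if $\theta=0$, put $\gamma=1$. Let $\psi$ be a positive, decreasing (not necessarily strictly) function on the positive integers for which the limit $\tau=\lambda(\psi):=-\lim_{q\to\infty}\frac{\log\psi(q)}{\log q}$ exists in $\mathbb{R}$, and suppose that $$\tau>\frac{2+\gamma^2+\sqrt{(2+\gamma^2)^2-4}}{2}.$$ Let $\mathrm{Exact}(\psi,\theta)$ be the set of real $x$ such that $\left|x-\frac{r-\theta}{q}\right|\le\psi(q)$ for infinitely many pairs $(r,q)$ of relatively prime integers with $q\ge1$, while for every $c>0$ the inequality $\left|x-\frac{r-\theta}{q}\right|\le\psi(q)-c\,\psi(q)$ holds for only finitely many such pairs. For $E\subset\mathbb{R}$ let the Fourier dimension $\dim_F E$ be the supremum of the $s\in[0,1]$ for which there are a Borel probability measure $\mu$ with compact support contained in $E$ and a constant $C$ such that $|\hat\mu(\xi)|\le C|\xi|^{-s/2}$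 for all real $\xi\ne0$, where $\hat\mu(\xi)=\int e^{-2\pi i x\xi}\,d\mu(x)$ (with $\dim_F E=0$ if there is no such $s$). Then, with $\beta=\gamma^{-2}(\tau-1)^2$, $$\dim_F \mathrm{Exact}(\psi,\theta)\ \ge\ \frac{2(\beta-\tau)}{\tau(\beta-1)}\ >\ 0.$$ Consequently, $\mathrm{Exact}(\psi,\theta)$ contains a normal number, that is, a real number $x$ such that for every integer $b\ge2$ the sequence $(b^n x)_{n\ge0}$ is uniformly distributed modulo $1$. -/

import Mathlib

open Filter Topology MeasureTheory

noncomputable section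

namespace ExactOrder

/-- The pairs `(r, q)` of relatively prime integers, `q ≥ 1`, with `|x - (r - θ) / q| ≤ f q`. -/
def approxPairs (f : ℕ → ℝ) (θ x : ℝ) : Set (ℤ × ℕ) :=
  {p | 1 ≤ p.2 ∧ IsCoprime p.1 (p.2 : ℤ) ∧ |x - ((p.1 : ℝ) - θ) / (p.2 : ℝ)| ≤ f p.2}

/-- The set of (inhomogeneous) exact approximation order `ψ`. -/
def Exact (ψ : ℕ → ℝ) (θ : ℝ) : Set ℝ :=
  {x | (approxPairs ψ θ x).Infinite ∧
    ∀ c : ℝ, 0 < c → (approxPairs (fun q => ψ q - c * ψ q) θ x).Finite}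

/-- `ψ` has order `τ`: the limit defining `λ(ψ) = - lim log ψ(q) / log q` exists and equals `τ`. -/
def HasOrder (ψ : ℕ → ℝ) (τ : ℝ) : Prop :=
  Tendsto (fun q : ℕ => -(Real.log (ψ q) / Real.log (q : ℝ))) atTop (𝓝 τ)

/-- `γ` is the Diophantine approximation exponent of `θ`, i.e. the infimum of those `g` for which
`|θ - p / q| ≤ q ^ (-g)` has only finitely many integer solutions. No real `γ` is a greatest lower
bound of the empty set, so this includes that the exponent is finite. -/
def HasDiophantineExponent (θ γ : ℝ) : Prop :=
  IsGLB {g : ℝ | {p : ℤ × ℕ | 1 ≤ p.2 ∧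
    |θ - (p.1 : ℝ) / (p.2 : ℝ)| ≤ (p.2 : ℝ) ^ (-g)}.Finite} γ

/-- The Fourier transform of a finite Borel measure on the line. -/
def fourierMeasure (μ : Measure ℝ) (ξ : ℝ) : ℂ :=
  ∫ x, Complex.exp (-2 * Real.pi * Complex.I * (x : ℂ) * (ξ : ℂ)) ∂μ

/-- `E` carries a Borel probability measure, with compact support contained in `E`,
whose Fourier transform is `O(|ξ| ^ (-s / 2))`. -/
def SupportsFourierDecay (E : Set ℝ) (s : ℝ) : Prop :=
  ∃ μ : Measure ℝ, IsProbabilityMeasure μ ∧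
    (∃ K : Set ℝ, IsCompact K ∧ K ⊆ E ∧ μ Kᶜ = 0) ∧
    ∃ C : ℝ, ∀ ξ : ℝ, ξ ≠ 0 → ‖fourierMeasure μ ξ‖ ≤ C * |ξ| ^ (-s / 2)

/-- The Fourier dimension of a subset of the line. -/
def fourierDim (E : Set ℝ) : ℝ :=
  sSup {s : ℝ | 0 ≤ s ∧ s ≤ 1 ∧ SupportsFourierDecay E s}

/-- Uniform distribution modulo one of a sequence of real numbers. -/
def EquidistributedModOne (u : ℕ → ℝ) : Prop :=
  ∀ a b : ℝ, 0 ≤ a → a < b → b ≤ 1 →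
    Tendsto (fun N : ℕ =>
        (Nat.card {n : ℕ // n < N ∧ Int.fract (u n) ∈ Set.Ico a b} : ℝ) / (N : ℝ))
      atTop (𝓝 (b - a))

/-- `x` is normal: for every integer base `b ≥ 2`, the sequence `b ^ n * x` is uniformly
distributed modulo one. -/
def IsNormalNumber (x : ℝ) : Prop :=
  ∀ b : ℕ, 2 ≤ b → EquidistributedModOne (fun n => (b : ℝ) ^ n * x)

end ExactOrder

end

/-! The set contains a Cantor-like set carrying a measure with Fourier decay. Take scales M_{k+1} =
M_k^ρ with ρ slightly below β. At each scale demand that x lie just inside the right end of the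
interval of radius ψ(q) about some (r - θ)/q, with q prime between M^{1-ε} and M. Then x - (r - θ)/q
lies between (1 - q^{-ε})ψ(q) and ψ(q), so these pairs approximate x to order ψ and, in the long
run, no better.

No other pair interferes, because shifted fractions repel (`Separated`). If (r', n) also
approximates x, then n^g ≫ q_k^{τ'-1} when n ≥ q_k, and q_k^g ≫ n^{τ'-1} when n ≤ q_k. So n avoids a
window from q_k^{g/(τ'-1)} to q_k^{(τ'-1)/g}, up to constants. Consecutive windows overlap once
q_{k+1} ≤ q_k^b with b < ((τ'-1)/g)^2, and this bound tends to β as g → γ and τ' → τ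
(`mem_Exact_of_sequence`).

The measure is a weak limit of products of kernels. Averaging periodized bumps over the primes at
scale M leaves only nonzero frequencies divisible by one of those primes. Few primes divide a given
frequency, so the coefficients are about 1/M up to frequency M^τ (`exists_prime_kernel`).
Multiplying a density of decay σ at scale L by such a kernel, with coefficients B and scale L',
costs about B L^{1-σ} L'^σ relative to the new decay profile (`exists_norm_fourier_mul_sub_le`).
With B = 1/M_{k+1}, L = M_k^τ and L' = M_{k+1}^τ the cost is a negative power of M_{k+1} exactly
when στ(β-1) < β-τ, which gives the dimension 2σ. The threshold on τ says precisely that β > τ.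

Polynomial Fourier decay makes almost every point normal: second moments of Weyl sums are O(N), and
the argument of Davenport, Erdős and LeVeque applies (`ae_isNormalNumber`). -/

namespace ExactOrder

open scoped FourierTransform ContDiff

/-! ### Decay profiles and multiplication by a kernel -/

/-- The decay profile `min ((1 + |t|) ^ (-σ)) (L ^ (2 - σ) * (1 + |t|) ^ (-2))`: order `σ` up to
the frequency `L`, order two beyond it. -/
noncomputable def decayWeight (σ L t : ℝ) : ℝ :=
  min ((1 + |t|) ^ (-σ)) (L ^ (2 - σ) * (1 + |t|) ^ (-2 : ℝ))

lemma decayWeight_nonneg {σ L : ℝ} (hL : 1 ≤ L) (t : ℝ) : 0 ≤ decayWeight σ L t :=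
  le_min (by positivity) (by positivity)

lemma decayWeight_mono {σ L L' : ℝ} (hσ : σ ≤ 1) (hL : 1 ≤ L) (h : L ≤ L') (t : ℝ) :
    decayWeight σ L t ≤ decayWeight σ L' t := by
  unfold decayWeight
  gcongr
  linarith

lemma decayWeight_le_one {σ : ℝ} (hσ : 0 ≤ σ) (L t : ℝ) : decayWeight σ L t ≤ 1 :=
  (min_le_left _ _).trans (Real.rpow_le_one_of_one_le_of_nonpos
    (by linarith [abs_nonneg t]) (by linarith))

/-- The two branches cross at `a = L`. The profile is traded for a summable power at the price of
essentially its total mass, `L ^ (1 - σ)`. -/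
lemma min_rpow_le_interpolation {σ ε L a : ℝ} (hσ : σ ≤ 1) (hε : 0 < ε) (hε' : ε ≤ 1)
    (hL : 1 ≤ L) (ha : 1 ≤ a) :
    min (a ^ (-σ)) (L ^ (2 - σ) * a ^ (-2 : ℝ)) ≤ L ^ (1 - σ + ε) * a ^ (-(1 + ε)) := by
  have ha0 : 0 < a := by linarith
  have hL0 : 0 < L := by linarith
  rcases le_total a L with h | h
  · refine (min_le_left _ _).trans ?_
    have : a ^ (-σ) = a ^ (1 - σ + ε) * a ^ (-(1 + ε)) := by
      rw [← Real.rpow_add ha0]; ring_nf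
    rw [this]
    gcongr
  · refine (min_le_right _ _).trans ?_
    have h1 : L ^ (2 - σ) = L ^ (1 - σ + ε) * L ^ (1 - ε) := by
      rw [← Real.rpow_add hL0]; ring_nf
    have h2 : a ^ (-(1 + ε)) = a ^ (1 - ε) * a ^ (-2 : ℝ) := by
      rw [← Real.rpow_add ha0]; ring_nf
    rw [h1, h2, mul_assoc]
    gcongr

/-- Pointwise convolution estimate, used with `x = 1 + |ξ|`, `a = 1 + |ξ - j|`, `b = 1 + |j|`. Below
`L'` the first factor is at most 1 and the target profile at least `L' ^ (-σ)`. Above `L'`, one of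
`a`, `b` is at least `x / 2`: its quadratic tail supplies the decay in `x`, with 4 the cost of
halving, and the other factor is interpolated to be summable in `j`. -/
lemma min_mul_min_le {σ ε L L' a b x : ℝ} (hσ0 : 0 ≤ σ) (hσ : σ ≤ 1) (hε : 0 < ε) (hε' : ε ≤ 1)
    (hL : 1 ≤ L) (hLL' : L ≤ L') (ha : 1 ≤ a) (hb : 1 ≤ b) (hx : 1 ≤ x) (hxab : x ≤ a + b) :
    min (b ^ (-0 : ℝ)) (L' ^ (2 - 0 : ℝ) * b ^ (-2 : ℝ)) *
        min (a ^ (-σ)) (L ^ (2 - σ) * a ^ (-2 : ℝ)) ≤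
      4 * (L ^ (1 - σ + ε) * L' ^ σ) * min (x ^ (-σ)) (L' ^ (2 - σ) * x ^ (-2 : ℝ)) *
        (a ^ (-(1 + ε)) + b ^ (-(1 + ε))) := by
  have ha0 : 0 < a := by linarith
  have hb0 : 0 < b := by linarith
  have hx0 : 0 < x := by linarith
  have hL0 : 0 < L := by linarith
  have hL'0 : 0 < L' := by linarith
  have hA := min_rpow_le_interpolation hσ hε hε' hL ha
  have hB := min_rpow_le_interpolation (σ := 0) zero_le_one hε hε' (hL.trans hLL') hb
  have hA0 : 0 ≤ min (a ^ (-σ)) (L ^ (2 - σ) * a ^ (-2 : ℝ)) :=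
    le_min (by positivity) (by positivity)
  have half : ∀ y : ℝ, x / 2 ≤ y → y ^ (-2 : ℝ) ≤ 4 * x ^ (-2 : ℝ) := by
    intro y hy
    have h4 : (4 : ℝ) * x ^ (-2 : ℝ) = (x / 2) ^ (-2 : ℝ) := by
      rw [Real.div_rpow hx0.le (by norm_num)]
      rw [Real.rpow_neg (by norm_num : (0:ℝ) ≤ 2)]
      norm_num
      ring
    rw [h4]
    exact Real.rpow_le_rpow_of_nonpos (by positivity) hy (by norm_num)
  rcases le_total x L' with h | h
  · have hm : L' ^ (-σ) ≤ min (x ^ (-σ)) (L' ^ (2 - σ) * x ^ (-2 : ℝ)) := by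
      refine le_min (Real.rpow_le_rpow_of_nonpos hx0 h (by linarith)) ?_
      have : L' ^ (-σ) = L' ^ (2 - σ) * L' ^ (-2 : ℝ) := by
        rw [← Real.rpow_add hL'0]; ring_nf
      rw [this]
      gcongr ?_ * ?_
      exact Real.rpow_le_rpow_of_nonpos hx0 h (by norm_num)
    have h1 : L' ^ σ * L' ^ (-σ) = 1 := by
      rw [← Real.rpow_add hL'0]; simp
    calc _ ≤ 1 * (L ^ (1 - σ + ε) * a ^ (-(1 + ε))) := by
          gcongr
          exact (min_le_left _ _).trans (by simp)
      _ = 1 * (L ^ (1 - σ + ε) * (L' ^ σ * L' ^ (-σ))) * a ^ (-(1 + ε)) := by rw [h1]; ring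
      _ ≤ 4 * (L ^ (1 - σ + ε) * (L' ^ σ * min (x ^ (-σ)) (L' ^ (2 - σ) * x ^ (-2 : ℝ)))) *
            (a ^ (-(1 + ε)) + b ^ (-(1 + ε))) := by
          gcongr
          · norm_num
          · linarith [Real.rpow_nonneg hb0.le (-(1 + ε))]
      _ = _ := by ring
  · have hm : L' ^ (2 - σ) * x ^ (-2 : ℝ) ≤ min (x ^ (-σ)) (L' ^ (2 - σ) * x ^ (-2 : ℝ)) := by
      refine le_min ?_ le_rfl
      have : x ^ (-σ) = x ^ (2 - σ) * x ^ (-2 : ℝ) := by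
        rw [← Real.rpow_add hx0]; ring_nf
      rw [this]
      gcongr
      linarith
    have key : L' ^ (2 - 0 : ℝ) = L' ^ σ * L' ^ (2 - σ) := by
      rw [← Real.rpow_add hL'0]; ring_nf
    rcases le_total (x / 2) b with hbx | hbx
    · calc _ ≤ (L' ^ (2 - 0 : ℝ) * (4 * x ^ (-2 : ℝ))) * (L ^ (1 - σ + ε) * a ^ (-(1 + ε))) := by
            gcongr
            exact (min_le_right _ _).trans (by gcongr; exact half b hbx)
        _ = 4 * (L ^ (1 - σ + ε) * L' ^ σ) * (L' ^ (2 - σ) * x ^ (-2 : ℝ)) * a ^ (-(1 + ε)) := by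
            rw [key]; ring
        _ ≤ _ := by
            gcongr
            linarith [Real.rpow_nonneg hb0.le (-(1 + ε))]
    · have hax : x / 2 ≤ a := by linarith
      have h5 : L ^ (2 - σ) * L' ^ (1 - 0 + ε) ≤ L ^ (1 - σ + ε) * L' ^ σ * L' ^ (2 - σ) := by
        have e1 : L ^ (2 - σ) = L ^ (1 - σ + ε) * L ^ (1 - ε) := by
          rw [← Real.rpow_add hL0]; ring_nf
        have e2 : L' ^ σ * L' ^ (2 - σ) = L' ^ (1 - ε) * L' ^ (1 - 0 + ε) := by
          rw [← Real.rpow_add hL'0, ← Real.rpow_add hL'0]; ring_nf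
        rw [mul_assoc, e1, e2, mul_assoc]
        gcongr
      calc _ ≤ (L' ^ (1 - 0 + ε) * b ^ (-(1 + ε))) * (L ^ (2 - σ) * (4 * x ^ (-2 : ℝ))) := by
            gcongr
            exact (min_le_right _ _).trans (by gcongr; exact half a hax)
        _ = 4 * (L ^ (2 - σ) * L' ^ (1 - 0 + ε)) * x ^ (-2 : ℝ) * b ^ (-(1 + ε)) := by ring
        _ ≤ 4 * (L ^ (1 - σ + ε) * L' ^ σ * L' ^ (2 - σ)) * x ^ (-2 : ℝ) * b ^ (-(1 + ε)) := by
            gcongr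
        _ = 4 * (L ^ (1 - σ + ε) * L' ^ σ) * (L' ^ (2 - σ) * x ^ (-2 : ℝ)) * b ^ (-(1 + ε)) := by
            ring
        _ ≤ _ := by
            gcongr
            linarith [Real.rpow_nonneg ha0.le (-(1 + ε))]

lemma summable_one_add_abs_int_rpow {p : ℝ} (hp : 1 < p) :
    Summable fun j : ℤ => (1 + |(j : ℝ)|) ^ (-p) := by
  refine Summable.of_norm_bounded_eventually (Real.summable_abs_int_rpow hp) ?_
  filter_upwards [(Set.finite_singleton (0 : ℤ)).compl_mem_cofinite] with j hj
  have hj0 : (0 : ℝ) < |(j : ℝ)| := by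
    have : j ≠ 0 := by simpa using hj
    positivity
  rw [Real.norm_of_nonneg (by positivity)]
  exact Real.rpow_le_rpow_of_nonpos hj0 (by linarith) (by linarith)

/-- The sums `∑ j, (1 + |ξ - j|) ^ (-p)` over the integers are bounded uniformly in `ξ`. -/
lemma exists_tsum_one_add_abs_sub_rpow_le {p : ℝ} (hp : 1 < p) :
    ∃ K : ℝ, 0 < K ∧ ∀ ξ : ℝ, (Summable fun j : ℤ => (1 + |ξ - j|) ^ (-p)) ∧
      ∑' j : ℤ, (1 + |ξ - j|) ^ (-p) ≤ K := by
  have hs := (summable_one_add_abs_int_rpow hp).mul_left (2 ^ p)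
  have hpos : 0 < ∑' j : ℤ, (2 : ℝ) ^ p * (1 + |(j : ℝ)|) ^ (-p) :=
    hs.tsum_pos (fun j => by positivity) 0 (by positivity)
  refine ⟨_, hpos, fun ξ => ?_⟩
  have hle : ∀ j : ℤ, (1 + |ξ - ((j + ⌊ξ⌋ : ℤ) : ℝ)|) ^ (-p) ≤
      (2 : ℝ) ^ p * (1 + |(j : ℝ)|) ^ (-p) := by
    intro j
    have h1 : (2 : ℝ) ^ p * (1 + |(j : ℝ)|) ^ (-p) = ((1 + |(j : ℝ)|) / 2) ^ (-p) := by
      rw [Real.div_rpow (by positivity) (by norm_num), Real.rpow_neg (by norm_num : (0 : ℝ) ≤ 2)]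
      field_simp
    rw [h1]
    refine Real.rpow_le_rpow_of_nonpos (by positivity) ?_ (by linarith)
    have h2 : ξ - ((j + ⌊ξ⌋ : ℤ) : ℝ) = Int.fract ξ - j := by
      push_cast; rw [← Int.self_sub_floor]; ring
    rw [h2]
    have h3 : |(j : ℝ)| ≤ |Int.fract ξ - j| + |Int.fract ξ| := by
      have := abs_sub_abs_le_abs_sub (j : ℝ) (Int.fract ξ)
      rw [abs_sub_comm] at this
      linarith
    rw [abs_of_nonneg (Int.fract_nonneg ξ)] at h3
    linarith [Int.fract_lt_one ξ, abs_nonneg (Int.fract ξ - j)]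
  have hs' : Summable fun j : ℤ => (1 + |ξ - ((j + ⌊ξ⌋ : ℤ) : ℝ)|) ^ (-p) :=
    Summable.of_nonneg_of_le (fun j => by positivity) hle hs
  constructor
  · exact (Equiv.summable_iff (Equiv.addRight ⌊ξ⌋)
      (f := fun j : ℤ => (1 + |ξ - j|) ^ (-p))).1 hs'
  · rw [← Equiv.tsum_eq (Equiv.addRight ⌊ξ⌋) (fun j : ℤ => (1 + |ξ - j|) ^ (-p))]
    exact hs'.tsum_le_tsum hle hs

/-- Multiplying an integrable function by an absolutely convergent Fourier series. -/
lemma fourier_mul_eq_tsum {f F : ℝ → ℂ} {c : ℤ → ℂ} (hf : Integrable f)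
    (hc : Summable fun j => ‖c j‖)
    (hF : ∀ x : ℝ, HasSum (fun j : ℤ => c j * fourier j (x : UnitAddCircle)) (F x)) (ξ : ℝ) :
    HasSum (fun j : ℤ => c j * 𝓕 f (ξ - j)) (𝓕 (fun x => f x * F x) ξ) := by
  have hterm : ∀ (j : ℤ) (x : ℝ), Complex.exp (↑(-2 * Real.pi * x * ξ) * Complex.I) • (f x * (c j *
      fourier j (x : UnitAddCircle))) =
      c j * (Complex.exp (↑(-2 * Real.pi * x * (ξ - j)) * Complex.I) • f x) := by
    intro j x
    rw [fourier_coe_apply]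
    simp only [smul_eq_mul]
    have : Complex.exp (↑(-2 * Real.pi * x * (ξ - j)) * Complex.I) =
        Complex.exp (↑(-2 * Real.pi * x * ξ) * Complex.I) *
          Complex.exp (2 * Real.pi * Complex.I * j * x / (1 : ℝ)) := by
      rw [← Complex.exp_add]
      congr 1
      push_cast
      ring
    rw [this]
    ring
  have hint : ∀ j : ℤ, Integrable fun x : ℝ =>
      Complex.exp (↑(-2 * Real.pi * x * (ξ - j)) * Complex.I) • f x := by
    intro j
    refine (hf.norm).mono' ?_ ?_
    · have : Continuous fun x : ℝ => Complex.exp (↑(-2 * Real.pi * x * (ξ - j)) * Complex.I) := by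
        fun_prop
      exact this.aestronglyMeasurable.smul hf.1
    · filter_upwards with x
      rw [norm_smul, Complex.norm_exp_ofReal_mul_I, one_mul]
  have key := hasSum_integral_of_summable_integral_norm (μ := volume)
    (F := fun (j : ℤ) (x : ℝ) => c j *
      (Complex.exp (↑(-2 * Real.pi * x * (ξ - j)) * Complex.I) • f x))
    (fun j => (hint j).const_mul _) ?_
  · have h2 : ∀ x : ℝ, ∑' j : ℤ, c j *
        (Complex.exp (↑(-2 * Real.pi * x * (ξ - j)) * Complex.I) • f x) =
        Complex.exp (↑(-2 * Real.pi * x * ξ) * Complex.I) • (f x * F x) := by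
      intro x
      simp_rw [← hterm]
      exact (((hF x).mul_left (f x)).const_smul _).tsum_eq
    simp_rw [h2] at key
    rw [Real.fourier_real_eq_integral_exp_smul]
    convert! key using 2 with j
    rw [integral_const_mul, Real.fourier_real_eq_integral_exp_smul]
  · refine (hc.mul_right (∫ x, ‖f x‖)).congr fun j => ?_
    rw [← integral_const_mul]
    refine integral_congr_ae (Eventually.of_forall fun x => ?_)
    simp only [norm_mul, norm_smul, Complex.norm_exp_ofReal_mul_I, one_mul]

/-- Multiplication by a kernel whose nonzero frequencies are small perturbs the Fourier transform
of a function by a small multiple of the decay profile at the finer scale `L'`. -/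
theorem exists_norm_fourier_mul_sub_le {ε : ℝ} (hε : 0 < ε) (hε' : ε ≤ 1) :
    ∃ K : ℝ, 0 < K ∧ ∀ (σ L L' B C : ℝ) (f F : ℝ → ℂ) (c : ℤ → ℂ), 0 ≤ σ → σ ≤ 1 → 1 ≤ L →
      L ≤ L' → 0 ≤ B → 0 ≤ C → Integrable f →
      (∀ ξ, ‖𝓕 f ξ‖ ≤ C * decayWeight σ L ξ) → c 0 = 1 →
      (∀ j : ℤ, j ≠ 0 → ‖c j‖ ≤ B * decayWeight 0 L' j) →
      (∀ x : ℝ, HasSum (fun j : ℤ => c j * fourier j (x : UnitAddCircle)) (F x)) →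
      ∀ ξ, ‖𝓕 (fun x => f x * F x) ξ - 𝓕 f ξ‖ ≤
        K * C * B * L ^ (1 - σ + ε) * L' ^ σ * decayWeight σ L' ξ := by
  obtain ⟨K, hK, hKs⟩ := exists_tsum_one_add_abs_sub_rpow_le (p := 1 + ε) (by linarith)
  -- The 4 of `min_mul_min_le`, doubled for the two sums over `j`, centred at `ξ` and at 0.
  refine ⟨8 * K, by positivity, ?_⟩
  intro σ L L' B C f F c hσ0 hσ hL hLL' hB hC hf hfC hc0 hcB hF ξ
  have hL'1 := hL.trans hLL'
  have hshift : ∀ x : ℝ, ∀ j : ℤ, 1 ≤ 1 + |x - j| := fun x j => by linarith [abs_nonneg (x - j)]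
  have hcs : Summable fun j => ‖c j‖ := by
    refine Summable.of_norm_bounded_eventually
      (((summable_one_add_abs_int_rpow (p := 1 + ε) (by linarith)).mul_left
        (B * L' ^ (1 - 0 + ε)))) ?_
    filter_upwards [(Set.finite_singleton (0 : ℤ)).compl_mem_cofinite] with j hj
    rw [norm_norm, mul_assoc]
    refine (hcB j (by simpa using hj)).trans ?_
    gcongr
    exact min_rpow_le_interpolation zero_le_one hε hε' hL'1 (by linarith [abs_nonneg (j : ℝ)])
  have hsum := fourier_mul_eq_tsum hf hcs hF ξ
  -- The term `j = 0` is `𝓕 f ξ` itself since `c 0 = 1`; removing it leaves the perturbation.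
  have hsub := hsum.sub (hasSum_ite_eq (0 : ℤ) (𝓕 f ξ))
  set D := 4 * (L ^ (1 - σ + ε) * L' ^ σ) * decayWeight σ L' ξ with hD
  have hbound : ∀ j : ℤ, ‖c j * 𝓕 f (ξ - j) - (if j = 0 then 𝓕 f ξ else 0)‖ ≤
      (B * C * D) * ((1 + |ξ - j|) ^ (-(1 + ε)) + (1 + |(0 : ℝ) - j|) ^ (-(1 + ε))) := by
    intro j
    have hW := decayWeight_nonneg (σ := σ) hL'1 ξ
    split_ifs with hj
    · subst hj
      simp only [hc0, Int.cast_zero, sub_zero, one_mul, sub_self, norm_zero]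
      positivity
    · rw [sub_zero, norm_mul]
      calc ‖c j‖ * ‖𝓕 f (ξ - j)‖ ≤ (B * decayWeight 0 L' j) * (C * decayWeight σ L (ξ - j)) :=
            mul_le_mul (hcB j hj) (hfC _) (norm_nonneg _)
              (mul_nonneg hB (decayWeight_nonneg hL'1 _))
        _ = B * C * (decayWeight 0 L' j * decayWeight σ L (ξ - j)) := by ring
        _ ≤ B * C * (D * ((1 + |ξ - j|) ^ (-(1 + ε)) + (1 + |(0 : ℝ) - j|) ^ (-(1 + ε)))) := by
            refine mul_le_mul_of_nonneg_left ?_ (by positivity)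
            rw [zero_sub, abs_neg]
            refine min_mul_min_le hσ0 hσ hε hε' hL hLL' (hshift _ _) ?_ ?_ ?_
            · linarith [abs_nonneg (j : ℝ)]
            · linarith [abs_nonneg ξ]
            · have := abs_add_le (ξ - j) j
              rw [sub_add_cancel] at this
              linarith
        _ = _ := by ring
  have hs := ((hKs ξ).1.add (hKs 0).1).mul_left (B * C * D)
  rw [← hsub.tsum_eq]
  refine (tsum_of_norm_bounded hs.hasSum hbound).trans ?_
  rw [tsum_mul_left, (hKs ξ).1.tsum_add (hKs 0).1]
  have hD0 : 0 ≤ D := by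
    have := decayWeight_nonneg (σ := σ) hL'1 ξ
    positivity
  calc _ ≤ B * C * D * (K + K) := by
        gcongr
        · exact (hKs ξ).2
        · exact (hKs 0).2
    _ = _ := by rw [hD]; ring

/-! ### Bumps, weak limits and infinite products of kernels -/

/-- The Fourier transform of a smooth compactly supported function decays rapidly. -/
lemma exists_norm_fourier_le_of_contDiff {g : ℝ → ℂ} (hg : ContDiff ℝ ∞ g)
    (hg' : HasCompactSupport g) (k : ℕ) :
    ∃ C : ℝ, 1 ≤ C ∧ ∀ ξ : ℝ, ‖𝓕 g ξ‖ ≤ C * (1 + |ξ|) ^ (-(k : ℝ)) := by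
  obtain ⟨C, h⟩ : ∃ C : ℝ, ∀ ξ : ℝ, (1 + ‖ξ‖) ^ k *
      ‖iteratedFDeriv ℝ 0 (𝓕 (hg'.toSchwartzMap hg) : SchwartzMap ℝ ℂ) ξ‖ ≤ C :=
    ⟨_, SchwartzMap.one_add_le_sup_seminorm_apply (𝕜 := ℝ) (m := (k, 0)) (k := k) (n := 0)
      le_rfl le_rfl (𝓕 (hg'.toSchwartzMap hg))⟩
  refine ⟨max 1 C, le_max_left _ _, fun ξ => ?_⟩
  have h1 := h ξ
  rw [norm_iteratedFDeriv_zero, Real.norm_eq_abs] at h1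
  have h2 : (𝓕 (hg'.toSchwartzMap hg) : SchwartzMap ℝ ℂ) ξ = 𝓕 g ξ := by
    rw [SchwartzMap.fourier_coe]
    rfl
  rw [h2] at h1
  rw [Real.rpow_neg (by positivity), Real.rpow_natCast, ← div_eq_mul_inv,
    le_div_iff₀ (by positivity), mul_comm]
  exact h1.trans (le_max_right _ _)

/-- A smooth nonnegative bump of integral one, supported in a given interval. -/
lemma exists_smooth_bump (a : ℝ) {r : ℝ} (hr : 0 < r) :
    ∃ φ : ℝ → ℝ, ContDiff ℝ ∞ φ ∧ HasCompactSupport φ ∧ (∀ x, 0 ≤ φ x) ∧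
      (∀ x, r < |x - a| → φ x = 0) ∧ ∫ x, φ x = 1 := by
  let b : ContDiffBump a := ⟨r / 2, r, by positivity, by linarith⟩
  refine ⟨b.normed volume, b.contDiff_normed, b.hasCompactSupport_normed,
    b.nonneg_normed, fun x hx => ?_, b.integral_normed⟩
  have : x ∉ Function.support (b.normed volume) := by
    rw [b.support_normed_eq]
    simp only [Metric.mem_ball, Real.dist_eq, not_lt]
    exact hx.le
  simpa using this

lemma fourierMeasure_withDensity {f : ℝ → ℝ} (hf : Continuous f) (hf0 : ∀ x, 0 ≤ f x) (ξ : ℝ) :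
    fourierMeasure (volume.withDensity fun x => ENNReal.ofReal (f x)) ξ =
      𝓕 (fun x => (f x : ℂ)) ξ := by
  unfold fourierMeasure
  rw [Real.fourier_real_eq_integral_exp_smul]
  have : (fun x => ENNReal.ofReal (f x)) = fun x => ((f x).toNNReal : ENNReal) := rfl
  rw [this, integral_withDensity_eq_integral_smul (by fun_prop)]
  refine integral_congr_ae (Eventually.of_forall fun x => ?_)
  simp only [NNReal.smul_def, Real.coe_toNNReal _ (hf0 x), Complex.real_smul, smul_eq_mul]
  rw [mul_comm]
  congr 2
  push_cast
  ring

lemma fourier_ofReal_zero (f : ℝ → ℝ) : 𝓕 (fun x => (f x : ℂ)) 0 = ((∫ x, f x : ℝ) : ℂ) := by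
  rw [Real.fourier_real_eq_integral_exp_smul, ← integral_complex_ofReal]
  simp

/-- A weak limit of probability measures on a compact set, all of whose Fourier transforms obey
the same bound. -/
lemma exists_limit_measure {K : Set ℝ} (hK : IsCompact K) (ν : ℕ → ProbabilityMeasure ℝ)
    (hν : ∀ n, (ν n : Measure ℝ) Kᶜ = 0) (Z : ℕ → Set ℝ) (hZ : ∀ k, IsClosed (Z k))
    (hνZ : ∀ k n, k < n → (ν n : Measure ℝ) (Z k)ᶜ = 0) (w : ℝ → ℝ)
    (hw : ∀ n ξ, ‖fourierMeasure (ν n) ξ‖ ≤ w ξ) :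
    ∃ μ : Measure ℝ, IsProbabilityMeasure μ ∧ μ Kᶜ = 0 ∧ (∀ k, μ (Z k)ᶜ = 0) ∧
      ∀ ξ, ‖fourierMeasure μ ξ‖ ≤ w ξ := by
  have htight : IsTightMeasureSet {((μ : ProbabilityMeasure ℝ) : Measure ℝ) | μ ∈ Set.range ν} := by
    rw [isTightMeasureSet_iff_exists_isCompact_measure_compl_le]
    refine fun ε _ => ⟨K, hK, ?_⟩
    rintro _ ⟨_, ⟨n, rfl⟩, rfl⟩
    simp [hν n]
  have hcomp := isCompact_closure_of_isTightMeasureSet htight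
  -- A limit along an ultrafilter finer than `atTop` serves as well as a convergent subsequence.
  let U : Ultrafilter ℕ := hyperfilter ℕ
  have hU : (U : Filter ℕ) ≤ atTop := Nat.hyperfilter_le_atTop
  obtain ⟨μ, -, hμ⟩ := hcomp.ultrafilter_le_nhds (U.map ν)
    (by
      rw [Ultrafilter.coe_map, le_principal_iff, mem_map]
      exact univ_mem' fun n => subset_closure ⟨n, rfl⟩)
  have hμ' : Tendsto ν U (𝓝 μ) := hμ
  have hnull : ∀ A : Set ℝ, IsClosed A → (∀ᶠ n in atTop, (ν n : Measure ℝ) Aᶜ = 0) →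
      (μ : Measure ℝ) Aᶜ = 0 := by
    intro A hA hev
    have h1 := ProbabilityMeasure.le_liminf_measure_open_of_tendsto hμ' hA.isOpen_compl
    have h2 : liminf (fun n => (ν n : Measure ℝ) Aᶜ) (U : Filter ℕ) = 0 := by
      rw [liminf_congr (v := fun _ => (0 : ENNReal)) (hU hev)]
      simp
    rw [h2] at h1
    exact le_antisymm h1 zero_le
  refine ⟨μ, inferInstance, hnull K hK.isClosed (Eventually.of_forall hν),
    fun k => hnull _ (hZ k) ?_, fun ξ => ?_⟩
  · filter_upwards [eventually_gt_atTop k] with n hn using hνZ k n hn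
  · let e : BoundedContinuousFunction ℝ ℂ := BoundedContinuousFunction.ofNormedAddCommGroup
      (fun x : ℝ => Complex.exp (-2 * Real.pi * Complex.I * (x : ℂ) * (ξ : ℂ))) (by fun_prop) 1
      (fun x => by
        have : (-2 * Real.pi * Complex.I * (x : ℂ) * (ξ : ℂ)) =
          ((-2 * Real.pi * x * ξ : ℝ) : ℂ) * Complex.I := by push_cast; ring
        rw [this, Complex.norm_exp_ofReal_mul_I])
    rw [ProbabilityMeasure.tendsto_iff_forall_integral_rclike_tendsto ℂ] at hμ'
    exact le_of_tendsto (hμ' e).norm (Eventually.of_forall fun n => hw n ξ)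

/-- The successive products of an initial density with kernels. -/
noncomputable def partialDensity (φ : ℝ → ℝ) (F : ℕ → ℝ → ℝ) : ℕ → ℝ → ℝ
  | 0 => φ
  | k + 1 => fun x => partialDensity φ F k x * F k x

/-- Infinite products of kernels: if the `k`-th kernel is close enough to one in Fourier space
relative to the scales involved, the products of the kernels with a bump converge to a measure with
Fourier decay of order `σ`. -/
theorem exists_measure_of_kernels {σ ε : ℝ} (hσ0 : 0 ≤ σ) (hσ : σ ≤ 1) (hε : 0 < ε)
    (hε' : ε ≤ 1) :
    ∃ κ : ℝ, 0 < κ ∧ ∀ (L B : ℕ → ℝ) (F : ℕ → ℝ → ℝ) (c : ℕ → ℤ → ℂ) (Z : ℕ → Set ℝ),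
      1 ≤ L 0 → Monotone L → (∀ k, 0 ≤ B k) → (∀ k, Continuous (F k)) → (∀ k x, 0 ≤ F k x) →
      (∀ k, IsClosed (Z k)) → (∀ k x, x ∉ Z k → F k x = 0) → (∀ k, c k 0 = 1) →
      (∀ k j, j ≠ 0 → ‖c k j‖ ≤ B k * decayWeight 0 (L (k + 1)) j) →
      (∀ (k : ℕ) (x : ℝ), HasSum (fun j : ℤ => c k j * fourier j (x : UnitAddCircle)) (F k x)) →
      (∀ k, B k * L k ^ (1 - σ + ε) * L (k + 1) ^ σ ≤ κ * (1 / 2) ^ k) →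
      ∃ μ : Measure ℝ, IsProbabilityMeasure μ ∧ μ (Set.Icc (1 / 4) (3 / 4))ᶜ = 0 ∧
        (∀ k, μ (Z k)ᶜ = 0) ∧
        ∃ C : ℝ, 0 ≤ C ∧ ∀ ξ, ‖fourierMeasure μ ξ‖ ≤ C * (1 + |ξ|) ^ (-σ) := by
  obtain ⟨K, hK, hstep⟩ := exists_norm_fourier_mul_sub_le hε hε'
  obtain ⟨φ, hφ, hφc, hφ0, hφs, hφ1⟩ := exists_smooth_bump (1 / 2) (r := 1 / 4) (by norm_num)
  obtain ⟨C, hC1, hC⟩ := exists_norm_fourier_le_of_contDiff (g := fun x => (φ x : ℂ))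
    (Complex.ofRealCLM.contDiff.comp hφ)
    (hφc.comp_left (g := fun x : ℝ => (x : ℂ)) Complex.ofReal_zero) 2
  -- Chosen so that, for densities bounded by `2 * C` times the profile, the `k`-th error is `1 / 4
  -- * (1 / 2) ^ k`. These errors add up to one half, so half of the mass survives.
  refine ⟨1 / (8 * K * C), by positivity, ?_⟩
  intro L B F c Z hL0 hLm hB hFc hF0 hZ hFZ hc0 hcB hF hκ
  have hL : ∀ k, 1 ≤ L k := fun k => hL0.trans (hLm (Nat.zero_le k))
  set f := partialDensity φ F with hf
  have hfsucc : ∀ k, f (k + 1) = fun x => f k x * F k x := fun k => rfl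
  have hfcont : ∀ k, Continuous (f k) := by
    intro k
    induction k with
    | zero => exact hφ.continuous
    | succ k ih => exact ih.mul (hFc k)
  have hf0 : ∀ k x, 0 ≤ f k x := by
    intro k
    induction k with
    | zero => exact hφ0
    | succ k ih => exact fun x => mul_nonneg (ih x) (hF0 k x)
  have hfs : ∀ k x, x ∉ Set.Icc (1 / 4 : ℝ) (3 / 4) → f k x = 0 := by
    intro k
    induction k with
    | zero =>
      intro x hx
      refine hφs x ?_
      by_contra! h
      rw [abs_le] at h
      exact hx ⟨by linarith, by linarith⟩
    | succ k ih => exact fun x hx => by rw [hfsucc]; simp [ih x hx]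
  have hfcs : ∀ k, HasCompactSupport (f k) := fun k =>
    HasCompactSupport.intro isCompact_Icc (hfs k)
  have hfi : ∀ k, Integrable (f k) := fun k => (hfcont k).integrable_of_hasCompactSupport (hfcs k)
  -- `f n` contains the factors `F 0, …, F (n - 1)`, hence the strict inequality.
  have hfZ : ∀ k n x, k < n → x ∉ Z k → f n x = 0 := by
    intro k n x hkn hx
    induction n, hkn using Nat.le_induction with
    | base => rw [hfsucc]; simp [hFZ k x hx]
    | succ n _ ih => rw [hfsucc]; simp [ih]
  have hfour : ∀ k, (fun x => ((f (k + 1) x : ℝ) : ℂ)) = fun x => (f k x : ℂ) * (F k x : ℂ) := by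
    intro k; ext x; rw [hfsucc]; push_cast; rfl
  have hdiff : ∀ k, (∀ ξ, ‖𝓕 (fun x => (f k x : ℂ)) ξ‖ ≤ 2 * C * decayWeight σ (L k) ξ) →
      ∀ ξ, ‖𝓕 (fun x => (f (k + 1) x : ℂ)) ξ - 𝓕 (fun x => (f k x : ℂ)) ξ‖ ≤
        1 / 4 * (1 / 2) ^ k * decayWeight σ (L (k + 1)) ξ := by
    intro k hk ξ
    rw [hfour]
    refine (hstep σ (L k) (L (k + 1)) (B k) (2 * C) _ (fun x => (F k x : ℂ)) (c k) hσ0 hσ (hL k)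
      (hLm (Nat.le_succ k)) (hB k) (by positivity) (hfi k).ofReal hk (hc0 k) (hcB k) (hF k)
      ξ).trans ?_
    refine mul_le_mul_of_nonneg_right ?_ (decayWeight_nonneg (hL _) _)
    calc _ = K * (2 * C) * (B k * L k ^ (1 - σ + ε) * L (k + 1) ^ σ) := by ring
      _ ≤ K * (2 * C) * (1 / (8 * K * C) * (1 / 2) ^ k) :=
          mul_le_mul_of_nonneg_left (hκ k) (by positivity)
      _ = 1 / 4 * (1 / 2) ^ k := by field_simp; norm_num
  -- The constant grows by `C * (1 / 2) ^ (k + 1)` at step `k`, which absorbs the new error because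
  -- `C ≥ 1`.
  have hdecay : ∀ k ξ, ‖𝓕 (fun x => (f k x : ℂ)) ξ‖ ≤
      (2 - (1 / 2) ^ k) * C * decayWeight σ (L k) ξ := by
    intro k
    induction k with
    | zero =>
      intro ξ
      have h1 : ((1 + |ξ|) ^ (-(2 : ℕ) : ℝ) : ℝ) ≤ decayWeight σ (L 0) ξ := by
        have hx : 1 ≤ 1 + |ξ| := by linarith [abs_nonneg ξ]
        push_cast
        refine le_min (Real.rpow_le_rpow_of_exponent_le hx (by linarith)) ?_
        refine le_mul_of_one_le_left (by positivity) (Real.one_le_rpow hL0 (by linarith))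
      calc _ ≤ _ := hC ξ
        _ ≤ C * decayWeight σ (L 0) ξ := by gcongr
        _ = _ := by norm_num
    | succ k ih =>
      intro ξ
      have hp : (0 : ℝ) < (1 / 2) ^ k := by positivity
      have hk : ∀ ξ, ‖𝓕 (fun x => (f k x : ℂ)) ξ‖ ≤ 2 * C * decayWeight σ (L k) ξ := by
        intro ξ
        refine (ih ξ).trans (mul_le_mul_of_nonneg_right ?_ (decayWeight_nonneg (hL _) _))
        nlinarith
      have h1 := hdiff k hk ξ
      have h2 := norm_le_norm_add_norm_sub (𝓕 (fun x => (f k x : ℂ)) ξ)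
        (𝓕 (fun x => (f (k + 1) x : ℂ)) ξ)
      rw [norm_sub_rev] at h2
      have h3 := decayWeight_mono hσ (hL k) (hLm (Nat.le_succ k)) ξ
      have h4 := decayWeight_nonneg (σ := σ) (hL (k + 1)) ξ
      have h5 : (1 / 2 : ℝ) ^ k ≤ 1 := pow_le_one₀ (by norm_num) (by norm_num)
      calc _ ≤ (2 - (1 / 2) ^ k) * C * decayWeight σ (L (k + 1)) ξ +
            1 / 4 * (1 / 2) ^ k * decayWeight σ (L (k + 1)) ξ := by
            have : (2 - (1 / 2) ^ k) * C * decayWeight σ (L k) ξ ≤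
              (2 - (1 / 2) ^ k) * C * decayWeight σ (L (k + 1)) ξ := by
                refine mul_le_mul_of_nonneg_left h3 ?_
                have : (0 : ℝ) ≤ 2 - (1 / 2) ^ k := by linarith
                positivity
            linarith [ih ξ]
        _ = ((2 - (1 / 2) ^ k) * C + 1 / 4 * (1 / 2) ^ k) * decayWeight σ (L (k + 1)) ξ := by ring
        _ ≤ _ := by
          refine mul_le_mul_of_nonneg_right ?_ h4
          rw [pow_succ]
          nlinarith
  have hdecay2 : ∀ k ξ, ‖𝓕 (fun x => (f k x : ℂ)) ξ‖ ≤ 2 * C * decayWeight σ (L k) ξ := by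
    intro k ξ
    refine (hdecay k ξ).trans (mul_le_mul_of_nonneg_right ?_ (decayWeight_nonneg (hL _) _))
    have hp : (0 : ℝ) < (1 / 2) ^ k := by positivity
    nlinarith
  -- Frequency 0 of the same perturbation bound: the mass starts at 1 and loses at most `1 / 4 * (1
  -- / 2) ^ k` at step `k`.
  have hmass : ∀ k, 1 / 2 + 1 / 2 * (1 / 2) ^ k ≤ ∫ x, f k x := by
    intro k
    induction k with
    | zero => change _ ≤ ∫ x, φ x; rw [hφ1]; norm_num
    | succ k ih =>
      have h1 := hdiff k (hdecay2 k) 0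
      rw [fourier_ofReal_zero, fourier_ofReal_zero, ← Complex.ofReal_sub, Complex.norm_real,
        Real.norm_eq_abs] at h1
      have h2 := decayWeight_le_one hσ0 (L (k + 1)) 0
      have h3 := neg_abs_le ((∫ x, f (k + 1) x) - ∫ x, f k x)
      have hp : (0 : ℝ) < (1 / 2) ^ k := by positivity
      rw [pow_succ]
      nlinarith
  have hmass' : ∀ k, 1 / 2 ≤ ∫ x, f k x := by
    intro k
    have hp : (0 : ℝ) < (1 / 2) ^ k := by positivity
    linarith [hmass k]
  set g : ℕ → ℝ → ℝ := fun k x => (∫ y, f k y)⁻¹ * f k x with hg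
  have hg0 : ∀ k x, 0 ≤ g k x := fun k x =>
    mul_nonneg (inv_nonneg.2 (by linarith [hmass' k])) (hf0 k x)
  have hgc : ∀ k, Continuous (g k) := fun k => continuous_const.mul (hfcont k)
  have hgnull : ∀ k (A : Set ℝ), MeasurableSet A → (∀ x, x ∉ A → f k x = 0) →
      (volume.withDensity fun x => ENNReal.ofReal (g k x)) Aᶜ = 0 := by
    intro k A hA h
    rw [withDensity_apply _ hA.compl]
    rw [setLIntegral_congr_fun (g := fun _ => 0) hA.compl
      (fun x hx => by simp [hg, h x hx])]
    simp
  have hprob : ∀ k, IsProbabilityMeasure (volume.withDensity fun x => ENNReal.ofReal (g k x)) := by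
    intro k
    refine ⟨?_⟩
    rw [withDensity_apply _ MeasurableSet.univ, Measure.restrict_univ,
      ← ofReal_integral_eq_lintegral_ofReal ((hfi k).const_mul _) (Eventually.of_forall (hg0 k)),
      integral_const_mul, inv_mul_cancel₀ (by linarith [hmass' k]), ENNReal.ofReal_one]
  obtain ⟨μ, hμ, hμK, hμZ, hμF⟩ := exists_limit_measure
    (isCompact_Icc (a := (1 / 4 : ℝ)) (b := 3 / 4))
    (fun k => ⟨_, hprob k⟩) (fun k => hgnull k _ measurableSet_Icc (hfs k)) Z hZ
    (fun k n hkn => hgnull n _ (hZ k).measurableSet fun x hx => hfZ k n x hkn hx)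
    (fun ξ => 4 * C * (1 + |ξ|) ^ (-σ)) (by
      intro k ξ
      change ‖fourierMeasure (volume.withDensity fun x => ENNReal.ofReal (g k x)) ξ‖ ≤ _
      rw [fourierMeasure_withDensity (hgc k) (hg0 k)]
      have h1 : 𝓕 (fun x => (g k x : ℂ)) ξ =
          ((∫ y, f k y)⁻¹ : ℝ) * 𝓕 (fun x => (f k x : ℂ)) ξ := by
        rw [Real.fourier_real_eq_integral_exp_smul, Real.fourier_real_eq_integral_exp_smul,
          ← integral_const_mul]
        refine integral_congr_ae (Eventually.of_forall fun x => ?_)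
        simp only [hg, smul_eq_mul]
        push_cast
        ring
      rw [h1, norm_mul, Complex.norm_real, Real.norm_eq_abs,
        abs_of_nonneg (inv_nonneg.2 (by linarith [hmass' k]))]
      calc _ ≤ (1 / 2)⁻¹ * (2 * C * (1 + |ξ|) ^ (-σ)) := by
            gcongr
            · exact hmass' k
            · refine (hdecay2 k ξ).trans ?_
              gcongr
              exact min_le_left _ _
        _ = _ := by norm_num; ring)
  exact ⟨μ, hμ, hμK, hμZ, 4 * C, by positivity, hμF⟩

/-! ### Kernels averaged over primes -/

lemma fourier_rescale (φ : ℝ → ℂ) {η : ℝ} (hη : 0 < η) (ξ : ℝ) :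
    𝓕 (fun x => (η⁻¹ : ℂ) * φ (x / η)) ξ = 𝓕 φ (η * ξ) := by
  rw [Real.fourier_real_eq_integral_exp_smul, Real.fourier_real_eq_integral_exp_smul]
  have h := Measure.integral_comp_div
    (fun v : ℝ => Complex.exp (↑(-2 * Real.pi * v * (η * ξ)) * Complex.I) • φ v) η
  rw [abs_of_pos hη] at h
  have h2 : ∀ v : ℝ, Complex.exp (↑(-2 * Real.pi * v * ξ) * Complex.I) • ((η⁻¹ : ℂ) * φ (v / η)) =
      (η⁻¹ : ℂ) * (Complex.exp (↑(-2 * Real.pi * (v / η) * (η * ξ)) * Complex.I) • φ (v / η)) := by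
    intro v
    have : -2 * Real.pi * (v / η) * (η * ξ) = -2 * Real.pi * v * ξ := by field_simp
    rw [this]
    simp only [smul_eq_mul]
    ring
  simp_rw [h2]
  rw [integral_const_mul, h, Complex.real_smul, ← mul_assoc, inv_mul_cancel₀, one_mul]
  exact_mod_cast hη.ne'

/-- Periodization of a bump at scale `η`, with its Fourier series. -/
lemma exists_periodization {φ : ℝ → ℝ} (hφ : ContDiff ℝ ∞ φ)
    (hφ0 : ∀ x, 0 ≤ φ x) (hφs : ∀ x, 1 < |x| → φ x = 0) {η : ℝ} (hη : 0 < η) :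
    ∃ Φ : ℝ → ℝ, (∀ y, 0 ≤ Φ y) ∧ (∀ y, Φ y ≠ 0 → ∃ n : ℤ, |y - n| ≤ η) ∧
      ∀ y : ℝ, HasSum (fun m : ℤ => 𝓕 (fun x => (φ x : ℂ)) (η * m) *
        fourier m (y : UnitAddCircle)) (Φ y) := by
  let g : ℝ → ℝ := fun x => η⁻¹ * φ (x / η)
  have hg : ContDiff ℝ ∞ fun x => (g x : ℂ) :=
    Complex.ofRealCLM.contDiff.comp (contDiff_const.mul (hφ.comp (contDiff_id.div_const η)))
  have hgs : ∀ x, η < |x| → g x = 0 := by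
    intro x hx
    have : φ (x / η) = 0 := hφs _ (by rwa [abs_div, abs_of_pos hη, one_lt_div hη])
    simp [g, this]
  have hgc : HasCompactSupport fun x => (g x : ℂ) := by
    refine HasCompactSupport.intro (isCompact_Icc (a := -η) (b := η)) fun x hx => ?_
    rw [hgs x (by by_contra! h; exact hx (abs_le.1 h)), Complex.ofReal_zero]
  have hgF : ∀ ξ, 𝓕 (fun x => (g x : ℂ)) ξ = 𝓕 (fun x => (φ x : ℂ)) (η * ξ) := by
    intro ξ
    rw [← fourier_rescale _ hη]
    simp [g]
  refine ⟨fun y => ∑' n : ℤ, g (y + n), fun y => tsum_nonneg fun n =>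
    mul_nonneg (by positivity) (hφ0 _), fun y hy => ?_, fun y => ?_⟩
  · by_contra! h
    refine hy ?_
    have : ∀ n : ℤ, g (y + n) = 0 := by
      intro n
      refine hgs _ ?_
      have := h (-n)
      push_cast at this
      rwa [sub_neg_eq_add] at this
    simp [this]
  · obtain ⟨C, -, hC⟩ := exists_norm_fourier_le_of_contDiff hg hgc 2
    have hs : Summable fun m : ℤ => 𝓕 (fun x => (φ x : ℂ)) (η * m) *
        fourier m (y : UnitAddCircle) := by
      refine Summable.of_norm_bounded ((summable_one_add_abs_int_rpow one_lt_two).mul_left C) ?_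
      intro m
      rw [norm_mul, ← hgF]
      have h1 : ‖fourier m (y : UnitAddCircle)‖ = 1 := (AddCircle.toCircle _).norm_coe
      rw [h1, mul_one]
      exact_mod_cast hC m
    have hp := SchwartzMap.tsum_eq_tsum_fourier (hgc.toSchwartzMap hg) y
    have h2 : ∀ ξ : ℝ, (𝓕 (hgc.toSchwartzMap hg) : SchwartzMap ℝ ℂ) ξ =
        𝓕 (fun x => (φ x : ℂ)) (η * ξ) := by
      intro ξ
      rw [SchwartzMap.fourier_coe, ← hgF]
      rfl
    have h3 : ((∑' n : ℤ, g (y + n) : ℝ) : ℂ) = ∑' n : ℤ, (hgc.toSchwartzMap hg) (y + n) := by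
      rw [Complex.ofReal_tsum]
      rfl
    rw [h3, hp]
    simp_rw [h2]
    exact hs.hasSum

/-- The Fourier coefficients of the periodization with peaks at the points `(r - θ) / q + a`. -/
noncomputable def shiftedCoeff (φ : ℝ → ℝ) (θ : ℝ) (q : ℕ) (a δ : ℝ) (j : ℤ) : ℂ :=
  if (q : ℤ) ∣ j then 𝓕 (fun x => (φ x : ℂ)) (δ * j) *
    fourier (j / q) ((θ - q * a : ℝ) : UnitAddCircle) else 0

/-- Evaluate the 1-periodic bump of width `q * δ` at `q * x + θ - q * a`. Only the frequencies `q *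
m` occur, and there `q * δ * m = δ * j`. -/
lemma exists_shifted_kernel {φ : ℝ → ℝ} (hφ : ContDiff ℝ ∞ φ)
    (hφ0 : ∀ x, 0 ≤ φ x) (hφs : ∀ x, 1 < |x| → φ x = 0) (θ : ℝ) {q : ℕ} (hq : 0 < q) (a : ℝ)
    {δ : ℝ} (hδ : 0 < δ) :
    ∃ F : ℝ → ℝ, (∀ x, 0 ≤ F x) ∧
      (∀ x, F x ≠ 0 → ∃ r : ℤ, |x - ((r : ℝ) - θ) / q - a| ≤ δ) ∧
      ∀ x : ℝ, HasSum (fun j : ℤ => shiftedCoeff φ θ q a δ j * fourier j (x : UnitAddCircle))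
        (F x) := by
  have hq' : (0 : ℝ) < q := by exact_mod_cast hq
  obtain ⟨Φ, hΦ0, hΦs, hΦ⟩ := exists_periodization hφ hφ0 hφs (mul_pos hq' hδ)
  refine ⟨fun x => Φ (q * x + (θ - q * a)), fun x => hΦ0 _, fun x hx => ?_, fun x => ?_⟩
  · obtain ⟨n, hn⟩ := hΦs _ hx
    refine ⟨n, ?_⟩
    have : x - ((n : ℝ) - θ) / q - a = (q * x + (θ - q * a) - n) / q := by field_simp; ring
    rw [this, abs_div, abs_of_pos hq', div_le_iff₀ hq', mul_comm δ]
    exact hn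
  · have hinj : Function.Injective fun m : ℤ => (q : ℤ) * m :=
      mul_right_injective₀ (by exact_mod_cast hq.ne')
    rw [← hinj.hasSum_iff]
    · refine (hΦ (q * x + (θ - q * a))).congr_fun fun m => ?_
      have h1 : ((q : ℤ) * m) / (q : ℤ) = m := Int.mul_ediv_cancel_left _ (by exact_mod_cast hq.ne')
      simp only [Function.comp, shiftedCoeff, dvd_mul_right, if_true, h1]
      have h2 : δ * (((q : ℤ) * m : ℤ) : ℝ) = q * δ * m := by push_cast; ring
      rw [h2, mul_assoc]
      congr 1
      rw [fourier_coe_apply, fourier_coe_apply, fourier_coe_apply, ← Complex.exp_add]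
      congr 1
      push_cast
      ring
    · intro j hj
      have : ¬ (q : ℤ) ∣ j := by
        rintro ⟨m, rfl⟩
        exact hj ⟨m, rfl⟩
      simp [shiftedCoeff, this]

/-- Distinct primes dividing `j` have a product dividing `j`, and each of them is at least `Q`. -/
lemma card_filter_dvd_mul_log_le {P : Finset ℕ} {Q : ℝ} (hQ : 1 ≤ Q)
    (hP : ∀ q ∈ P, q.Prime ∧ Q ≤ q) {j : ℤ} (hj : j ≠ 0) :
    ((P.filter fun q : ℕ => (q : ℤ) ∣ j).card : ℝ) * Real.log Q ≤ Real.log |(j : ℝ)| := by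
  set S := P.filter fun q : ℕ => (q : ℤ) ∣ j with hS
  have hdvd : ∏ q ∈ S, q ∣ j.natAbs := by
    refine Finset.prod_primes_dvd _ (fun q hq => ?_) fun q hq => ?_
    · exact (hP q (Finset.mem_filter.1 hq).1).1.prime
    · exact Int.natCast_dvd.1 (Finset.mem_filter.1 hq).2
  have h1 : ∏ q ∈ S, q ≤ j.natAbs := Nat.le_of_dvd (Int.natAbs_pos.2 hj) hdvd
  have h2 : Q ^ S.card ≤ |(j : ℝ)| := by
    calc Q ^ S.card = ∏ q ∈ S, Q := by rw [Finset.prod_const]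
      _ ≤ ∏ q ∈ S, (q : ℝ) := Finset.prod_le_prod (fun _ _ => by linarith)
          fun q hq => (hP q (Finset.mem_filter.1 hq).1).2
      _ = ((∏ q ∈ S, q : ℕ) : ℝ) := by push_cast; rfl
      _ ≤ (j.natAbs : ℝ) := by exact_mod_cast h1
      _ = |(j : ℝ)| := by rw [Nat.cast_natAbs, Int.cast_abs]
  rw [← Real.log_pow]
  exact Real.log_le_log (by positivity) h2

lemma continuous_of_hasSum_fourier {F : ℝ → ℝ} {c : ℤ → ℂ} (hc : Summable fun j => ‖c j‖)
    (hF : ∀ x : ℝ, HasSum (fun j : ℤ => c j * fourier j (x : UnitAddCircle)) (F x)) :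
    Continuous F := by
  have h : Continuous fun x : ℝ => ∑' j : ℤ, c j * fourier j (x : UnitAddCircle) := by
    refine continuous_tsum (fun j => ?_) hc fun j x => ?_
    · exact continuous_const.mul ((map_continuous (fourier j)).comp (AddCircle.continuous_mk' 1))
    · have h1 : ‖fourier j (x : UnitAddCircle)‖ = 1 := (AddCircle.toCircle _).norm_coe
      rw [norm_mul, h1, mul_one]
  have h2 : F = fun x : ℝ => (∑' j : ℤ, c j * fourier j (x : UnitAddCircle)).re := by
    ext x
    rw [(hF x).tsum_eq, Complex.ofReal_re]
  rw [h2]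
  exact Complex.continuous_re.comp h

/-- The average over a set `P` of primes of the periodizations with peaks at the points
`(r - θ) / q + a q` has small nonzero Fourier coefficients. -/
theorem exists_prime_kernel : ∃ C : ℝ, 0 < C ∧ ∀ (θ : ℝ) (P : Finset ℕ) (Q L A : ℝ) (a δ : ℕ → ℝ),
    P.Nonempty → (∀ q ∈ P, q.Prime ∧ Q ≤ q) → Real.exp 1 ≤ Q → 1 ≤ L → 0 ≤ A →
    Real.log L ≤ A * Real.log Q → (∀ q ∈ P, L⁻¹ ≤ δ q) →
    ∃ (F : ℝ → ℝ) (c : ℤ → ℂ), Continuous F ∧ (∀ x, 0 ≤ F x) ∧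
      (∀ x, F x ≠ 0 → ∃ q ∈ P, ∃ r : ℤ, |x - ((r : ℝ) - θ) / q - a q| ≤ δ q) ∧ c 0 = 1 ∧
      (∀ j, j ≠ 0 → ‖c j‖ ≤ C * (1 + A) / P.card * decayWeight 0 L j) ∧
      ∀ x : ℝ, HasSum (fun j : ℤ => c j * fourier j (x : UnitAddCircle)) (F x) := by
  obtain ⟨φ, hφ, hφc, hφ0, hφs, hφ1⟩ := exists_smooth_bump 0 (r := 1) one_pos
  simp only [sub_zero] at hφs
  -- Order three: beyond `L` one power pays for the number of primes dividing `j`, leaving the two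
  -- powers of the profile.
  obtain ⟨C, hC1, hC⟩ := exists_norm_fourier_le_of_contDiff (g := fun x => (φ x : ℂ))
    (Complex.ofRealCLM.contDiff.comp hφ)
    (hφc.comp_left (g := fun x : ℝ => (x : ℂ)) Complex.ofReal_zero) 3
  refine ⟨C, by linarith, ?_⟩
  intro θ P Q L A a δ hPne hP hQ hL hA hLQ hδ
  have hL0 : 0 < L := by linarith
  have hδ0 : ∀ q ∈ P, 0 < δ q := fun q hq => (inv_pos.2 hL0).trans_le (hδ q hq)
  choose! F hF0 hFs hF using fun q (hq : q ∈ P) =>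
    exists_shifted_kernel hφ hφ0 hφs θ (hP q hq).1.pos (a q) (hδ0 q hq)
  have hcard : (0 : ℝ) < P.card := by exact_mod_cast hPne.card_pos
  set c : ℤ → ℂ := fun j => (P.card : ℂ)⁻¹ * ∑ q ∈ P, shiftedCoeff φ θ q (a q) (δ q) j with hc
  have hQ1 : 1 ≤ Q := le_trans (by simp) hQ
  have hlogQ : 1 ≤ Real.log Q := by
    rw [← Real.log_exp 1]; exact Real.log_le_log (Real.exp_pos 1) hQ
  have hbound : ∀ j, j ≠ 0 → ‖c j‖ ≤ C * (1 + A) / P.card * decayWeight 0 L j := by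
    intro j hj
    set t := 1 + L⁻¹ * |(j : ℝ)| with ht
    have ht1 : 1 ≤ t := by
      have : 0 ≤ L⁻¹ * |(j : ℝ)| := by positivity
      linarith
    have hj0 : (0 : ℝ) < |(j : ℝ)| := by positivity
    have hterm : ∀ q ∈ P, ‖shiftedCoeff φ θ q (a q) (δ q) j‖ ≤
        if (q : ℤ) ∣ j then C * t ^ (-(3 : ℝ)) else 0 := by
      intro q hq
      unfold shiftedCoeff
      split_ifs with h
      · rw [norm_mul]
        have h1 : ‖fourier (j / q) ((θ - q * a q : ℝ) : UnitAddCircle)‖ = 1 :=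
          (AddCircle.toCircle _).norm_coe
        rw [h1, mul_one]
        refine (hC _).trans ?_
        push_cast
        gcongr ?_ * ?_
        refine Real.rpow_le_rpow_of_nonpos (by positivity) ?_ (by norm_num)
        rw [ht, abs_mul, abs_of_pos (hδ0 q hq)]
        gcongr
        exact hδ q hq
      · simp
    have hsum : ‖∑ q ∈ P, shiftedCoeff φ θ q (a q) (δ q) j‖ ≤
        (P.filter fun q : ℕ => (q : ℤ) ∣ j).card * (C * t ^ (-(3 : ℝ))) := by
      refine (norm_sum_le_of_le _ hterm).trans ?_
      rw [← Finset.sum_filter, Finset.sum_const, nsmul_eq_mul]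
    -- Splitting `log |j|` as `log (|j| / L) + log L` bounds the count by `A` plus a term of size
    -- `|j| / L`.
    have hN : ((P.filter fun q : ℕ => (q : ℤ) ∣ j).card : ℝ) ≤ (1 + A) * t := by
      have h1 := card_filter_dvd_mul_log_le hQ1 hP hj
      have h2 : Real.log |(j : ℝ)| ≤ L⁻¹ * |(j : ℝ)| + Real.log L := by
        have h3 : Real.log |(j : ℝ)| = Real.log (L⁻¹ * |(j : ℝ)|) + Real.log L := by
          rw [Real.log_mul (by positivity) hj0.ne', Real.log_inv]; ring
        rw [h3]
        linarith [Real.log_le_self (x := L⁻¹ * |(j : ℝ)|) (by positivity)]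
      have h4 : L⁻¹ * |(j : ℝ)| ≤ L⁻¹ * |(j : ℝ)| * Real.log Q :=
        le_mul_of_one_le_right (by positivity) hlogQ
      have h5 : ((P.filter fun q : ℕ => (q : ℤ) ∣ j).card : ℝ) * Real.log Q ≤
          (L⁻¹ * |(j : ℝ)| + A) * Real.log Q := by linarith
      have h6 := le_of_mul_le_mul_right h5 (by linarith)
      have h7 : 0 ≤ L⁻¹ * |(j : ℝ)| := by positivity
      rw [ht]
      nlinarith
    have hw : t ^ (-(2 : ℝ)) ≤ decayWeight 0 L j := by
      refine le_min ?_ ?_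
      · rw [neg_zero, Real.rpow_zero]
        exact Real.rpow_le_one_of_one_le_of_nonpos ht1 (by norm_num)
      · have h1 : L ^ (2 - 0 : ℝ) * (1 + |(j : ℝ)|) ^ (-2 : ℝ) =
            ((1 + |(j : ℝ)|) / L) ^ (-2 : ℝ) := by
          rw [Real.div_rpow (by positivity) hL0.le, Real.rpow_neg hL0.le, sub_zero]
          field_simp
        rw [h1]
        refine Real.rpow_le_rpow_of_nonpos (by positivity) ?_ (by norm_num)
        rw [ht, add_div, inv_mul_eq_div]
        gcongr
        exact (div_le_one hL0).2 hL
    have ht3 : t * t ^ (-(3 : ℝ)) = t ^ (-(2 : ℝ)) := by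
      rw [← Real.rpow_one_add' (by linarith) (by norm_num)]; norm_num
    rw [hc, norm_mul, norm_inv, Complex.norm_natCast]
    calc _ ≤ (P.card : ℝ)⁻¹ * ((1 + A) * t * (C * t ^ (-(3 : ℝ)))) := by
          gcongr
          exact hsum.trans (by gcongr)
      _ = C * (1 + A) / P.card * (t * t ^ (-(3 : ℝ))) := by field_simp
      _ ≤ _ := by rw [ht3]; gcongr
  have hFsum : ∀ x : ℝ, HasSum (fun j : ℤ => c j * fourier j (x : UnitAddCircle))
      (((P.card : ℝ)⁻¹ * ∑ q ∈ P, F q x : ℝ) : ℂ) := by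
    intro x
    have h := (hasSum_sum (s := P) fun q hq => hF q hq x).mul_left (P.card : ℂ)⁻¹
    push_cast
    refine h.congr_fun fun j => ?_
    simp only [hc]
    rw [mul_assoc, Finset.sum_mul]
  have hcs : Summable fun j => ‖c j‖ := by
    refine Summable.of_norm_bounded_eventually
      (((summable_one_add_abs_int_rpow (p := 1 + 1) (by norm_num)).mul_left
        (C * (1 + A) / P.card * L ^ (1 - 0 + 1 : ℝ)))) ?_
    filter_upwards [(Set.finite_singleton (0 : ℤ)).compl_mem_cofinite] with j hj
    rw [norm_norm, mul_assoc]
    refine (hbound j (by simpa using hj)).trans ?_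
    gcongr
    exact min_rpow_le_interpolation zero_le_one one_pos le_rfl hL
      (by linarith [abs_nonneg (j : ℝ)])
  refine ⟨fun x => (P.card : ℝ)⁻¹ * ∑ q ∈ P, F q x, c,
    continuous_of_hasSum_fourier hcs hFsum, fun x => ?_, fun x hx => ?_, ?_, hbound, hFsum⟩
  · exact mul_nonneg (by positivity) (Finset.sum_nonneg fun q hq => hF0 q hq x)
  · obtain ⟨q, hq, hqx⟩ := Finset.exists_ne_zero_of_sum_ne_zero (right_ne_zero_of_mul hx)
    exact ⟨q, hq, hFs q hq x hqx⟩
  · have h1 : ∀ q ∈ P, shiftedCoeff φ θ q (a q) (δ q) 0 = 1 := by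
      intro q _
      have h2 := fourier_ofReal_zero φ
      rw [hφ1] at h2
      simp only [shiftedCoeff, dvd_zero, if_true, Int.cast_zero, mul_zero, Int.zero_ediv,
        fourier_zero, mul_one, h2, Complex.ofReal_one]
    simp only [hc]
    rw [Finset.sum_congr rfl h1, Finset.sum_const, nsmul_eq_mul, mul_one, inv_mul_cancel₀]
    exact_mod_cast hcard.ne'

/-- The condition bounds the distance from `q * x + θ - q * a` to the nearest integer, a continuous
function of `x`. -/
lemma isClosed_setOf_exists_int_near (θ : ℝ) {q : ℕ} (hq : 0 < q) (a δ : ℝ) :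
    IsClosed {x : ℝ | ∃ r : ℤ, |x - ((r : ℝ) - θ) / q - a| ≤ δ} := by
  have hq' : (0 : ℝ) < q := by exact_mod_cast hq
  have hset : {x : ℝ | ∃ r : ℤ, |x - ((r : ℝ) - θ) / q - a| ≤ δ} =
      {x : ℝ | ‖((q * x + (θ - q * a) : ℝ) : UnitAddCircle)‖ ≤ q * δ} := by
    ext x
    have hiff : ∀ r : ℤ, |x - ((r : ℝ) - θ) / q - a| ≤ δ ↔ |q * x + (θ - q * a) - r| ≤ q * δ := by
      intro r
      have : x - ((r : ℝ) - θ) / q - a = (q * x + (θ - q * a) - r) / q := by field_simp; ring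
      rw [this, abs_div, abs_of_pos hq', div_le_iff₀ hq', mul_comm δ]
    simp only [Set.mem_ofPred_eq, hiff, UnitAddCircle.norm_eq]
    exact ⟨fun ⟨r, hr⟩ => (round_le _ _).trans hr, fun h => ⟨_, h⟩⟩
  rw [hset]
  refine isClosed_le (continuous_norm.comp ((AddCircle.continuous_mk' 1).comp ?_)) continuous_const
  fun_prop

/-! ### Repulsion of shifted fractions and exact approximation -/

lemma HasOrder.eventually_le {ψ : ℕ → ℝ} {τ τ' : ℝ} (h : HasOrder ψ τ)
    (hψ : ∀ q : ℕ, 1 ≤ q → 0 < ψ q) (hτ : τ' < τ) :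
    ∀ᶠ q : ℕ in atTop, ψ q ≤ (q : ℝ) ^ (-τ') := by
  filter_upwards [h.eventually (lt_mem_nhds hτ), eventually_ge_atTop 2] with q hq hq2
  have hq1 : (1 : ℝ) < q := by exact_mod_cast hq2
  have hlog := Real.log_pos hq1
  rw [← neg_div, lt_div_iff₀ hlog] at hq
  rw [← Real.log_le_log_iff (hψ q (by lia)) (by positivity), Real.log_rpow (by linarith)]
  linarith

lemma HasOrder.eventually_ge {ψ : ℕ → ℝ} {τ τ' : ℝ} (h : HasOrder ψ τ)
    (hψ : ∀ q : ℕ, 1 ≤ q → 0 < ψ q) (hτ : τ < τ') :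
    ∀ᶠ q : ℕ in atTop, (q : ℝ) ^ (-τ') ≤ ψ q := by
  filter_upwards [h.eventually (gt_mem_nhds hτ), eventually_ge_atTop 2] with q hq hq2
  have hq1 : (1 : ℝ) < q := by exact_mod_cast hq2
  have hlog := Real.log_pos hq1
  rw [← neg_div, div_lt_iff₀ hlog] at hq
  rw [← Real.log_le_log_iff (by positivity) (hψ q (by lia)), Real.log_rpow (by linarith)]
  linarith

/-- Rounding `Q * θ` gives an error at most `1 / Q` for every denominator `Q`, so exponents below 1
always have infinitely many solutions. -/
lemma one_le_of_finite_approximations {θ g : ℝ}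
    (h : {p : ℤ × ℕ | 1 ≤ p.2 ∧ |θ - (p.1 : ℝ) / (p.2 : ℝ)| ≤ (p.2 : ℝ) ^ (-g)}.Finite) :
    1 ≤ g := by
  by_contra! hg
  have hinj : Function.Injective fun q : ℕ => (round (((q + 1 : ℕ) : ℝ) * θ), q + 1) := by
    intro a b hab
    simpa using congrArg Prod.snd hab
  refine Set.infinite_of_injective_forall_mem hinj (fun q => ?_) h
  refine ⟨by simp, ?_⟩
  have hq : (1 : ℝ) ≤ ((q + 1 : ℕ) : ℝ) := by push_cast; linarith [(Nat.cast_nonneg q : (0:ℝ) ≤ q)]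
  have hq0 : (0 : ℝ) < ((q + 1 : ℕ) : ℝ) := by linarith
  simp only
  generalize ((q + 1 : ℕ) : ℝ) = Q at hq hq0
  have h1 : θ - (round (Q * θ) : ℝ) / Q = (Q * θ - round (Q * θ)) / Q := by field_simp
  rw [h1, abs_div, abs_of_pos hq0]
  calc _ ≤ 1 / Q := by
        gcongr
        linarith [abs_sub_round (Q * θ)]
    _ = Q ^ (-1 : ℝ) := by rw [Real.rpow_neg_one, one_div]
    _ ≤ Q ^ (-g) := Real.rpow_le_rpow_of_exponent_le hq (by linarith)

lemma HasDiophantineExponent.one_le {θ γ : ℝ} (h : HasDiophantineExponent θ γ) : 1 ≤ γ :=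
  h.2 fun _ hg => one_le_of_finite_approximations hg

/-- The finitely many exceptions are at positive distance from the irrational `θ`, so a small
constant absorbs them. -/
lemma exists_mul_rpow_le_abs_sub_div {θ g : ℝ} (hθ : Irrational θ)
    (h : {p : ℤ × ℕ | 1 ≤ p.2 ∧ |θ - (p.1 : ℝ) / (p.2 : ℝ)| ≤ (p.2 : ℝ) ^ (-g)}.Finite) :
    ∃ c : ℝ, 0 < c ∧ c ≤ 1 ∧ ∀ (p : ℤ) (q : ℕ), 1 ≤ q →
      c * (q : ℝ) ^ (-g) ≤ |θ - (p : ℝ) / (q : ℝ)| := by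
  have hpos : ∀ (p : ℤ) (q : ℕ), 0 < |θ - (p : ℝ) / (q : ℝ)| := by
    intro p q
    rw [abs_pos, sub_ne_zero]
    have := hθ.ne_rat ((p : ℚ) / q)
    push_cast at this
    exact this
  obtain ⟨c, hc, hc'⟩ : ∃ c : ℝ, 0 < c ∧ ∀ x ∈ h.toFinset,
      c ≤ |θ - (x.1 : ℝ) / (x.2 : ℝ)| * (x.2 : ℝ) ^ g := by
    by_cases hne : h.toFinset.Nonempty
    · obtain ⟨y, hy, hmin⟩ := h.toFinset.exists_min_image
        (fun x => |θ - (x.1 : ℝ) / (x.2 : ℝ)| * (x.2 : ℝ) ^ g) hne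
      have hy1 : (0 : ℝ) < y.2 := by
        have : 1 ≤ y.2 := ((Set.Finite.mem_toFinset h).1 hy).1
        exact_mod_cast this
      exact ⟨_, mul_pos (hpos _ _) (by positivity), hmin⟩
    · rw [Finset.not_nonempty_iff_eq_empty] at hne
      exact ⟨1, one_pos, by simp [hne]⟩
  refine ⟨min c 1, lt_min hc one_pos, min_le_right _ _, fun p q hq => ?_⟩
  have hq0 : (0 : ℝ) < q := by exact_mod_cast hq
  by_cases hpq : |θ - (p : ℝ) / (q : ℝ)| ≤ (q : ℝ) ^ (-g)
  · have := hc' (p, q) (by simpa using ⟨hq, hpq⟩)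
    rw [Real.rpow_neg hq0.le, ← div_eq_mul_inv, div_le_iff₀ (by positivity)]
    exact (min_le_left _ _).trans this
  · push Not at hpq
    refine le_trans ?_ hpq.le
    exact mul_le_of_le_one_left (by positivity) (min_le_right _ _)

/-- Distinct shifted fractions `(r - θ) / q` and `(r' - θ) / n` repel each other. -/
def Separated (θ g c : ℝ) : Prop :=
  ∀ (r r' : ℤ) (q n : ℕ), 1 ≤ q → 1 ≤ n → IsCoprime r (q : ℤ) → IsCoprime r' (n : ℤ) →
    (r, q) ≠ (r', n) →
    c / ((q : ℝ) * n * (max q n : ℝ) ^ (g - 1)) ≤ |((r : ℝ) - θ) / q - ((r' : ℝ) - θ) / n|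

lemma abs_shifted_sub_eq {θ : ℝ} (r r' : ℤ) {q n : ℕ} (hq : 1 ≤ q) (hn : 1 ≤ n) :
    |((r : ℝ) - θ) / q - ((r' : ℝ) - θ) / n| =
      |((r * n - r' * q : ℤ) : ℝ) - θ * ((n : ℝ) - q)| / (q * n) := by
  have hq0 : (0 : ℝ) < q := by exact_mod_cast hq
  have hn0 : (0 : ℝ) < n := by exact_mod_cast hn
  have : ((r : ℝ) - θ) / q - ((r' : ℝ) - θ) / n =
      (((r * n - r' * q : ℤ) : ℝ) - θ * ((n : ℝ) - q)) / (q * n) := by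
    push_cast; field_simp; ring
  rw [this, abs_div, abs_of_pos (mul_pos hq0 hn0)]

/-- Distinct reduced fractions: the numerator of the difference is a nonzero integer. -/
lemma separated_zero : Separated 0 1 1 := by
  intro r r' q n hq hn hrq hrn hne
  have hq0 : (0 : ℝ) < q := by exact_mod_cast hq
  have hn0 : (0 : ℝ) < n := by exact_mod_cast hn
  rw [abs_shifted_sub_eq r r' hq hn, sub_self, Real.rpow_zero, mul_one, zero_mul, sub_zero]
  gcongr
  have h : r * n - r' * q ≠ 0 := by
    intro h
    have h1 : r * (n : ℤ) = r' * q := by linarith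
    have hqn : (q : ℤ) ∣ n := hrq.symm.dvd_of_dvd_mul_left ⟨r', by rw [h1]; ring⟩
    have hnq : (n : ℤ) ∣ q := hrn.symm.dvd_of_dvd_mul_left ⟨r, by rw [← h1]; ring⟩
    have hqn' : q = n := Nat.dvd_antisymm (Int.natCast_dvd_natCast.1 hqn)
      (Int.natCast_dvd_natCast.1 hnq)
    subst hqn'
    have : r = r' := mul_right_cancel₀ (by exact_mod_cast (by lia : q ≠ 0)) h1
    exact hne (by rw [this])
  exact_mod_cast Int.one_le_abs h

/-- Over the denominator `q * n` the numerator is an integer minus `θ * (n - q)`. If `n = q` it is a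
nonzero integer. Otherwise it is `m * |θ - p / m|` for some integer `p`, with `m = |n - q|` at most
the maximum of the denominators, and the Diophantine bound for `θ` applies. -/
lemma exists_separated_of_irrational {θ γ ε : ℝ} (hθ : Irrational θ)
    (hγ : HasDiophantineExponent θ γ) (hε : 0 < ε) :
    ∃ g c : ℝ, 1 ≤ g ∧ g < γ + ε ∧ 0 < c ∧ Separated θ g c := by
  obtain ⟨g, hg, -, hgε⟩ := hγ.exists_between (show γ < γ + ε by linarith)
  have hg1 : 1 ≤ g := one_le_of_finite_approximations hg
  obtain ⟨c, hc, hc1, hcθ⟩ := exists_mul_rpow_le_abs_sub_div hθ hg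
  refine ⟨g, c, hg1, hgε, hc, ?_⟩
  intro r r' q n hq hn _ _ hne
  have hq0 : (0 : ℝ) < q := by exact_mod_cast hq
  have hn0 : (0 : ℝ) < n := by exact_mod_cast hn
  have hq1 : (1 : ℝ) ≤ q := by exact_mod_cast hq
  have hmax : (1 : ℝ) ≤ max (q : ℝ) n := le_max_of_le_left hq1
  rw [abs_shifted_sub_eq r r' hq hn, mul_comm, ← div_div]
  gcongr
  have hpow : c / (max (q : ℝ) n) ^ (g - 1) = c * (max (q : ℝ) n) ^ (1 - g) := by
    rw [div_eq_mul_inv, ← Real.rpow_neg (by linarith)]; ring_nf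
  rw [hpow]
  by_cases hqn : q = n
  · subst hqn
    rw [sub_self, mul_zero, sub_zero]
    have h1 : r * (q : ℤ) - r' * q ≠ 0 := by
      intro h
      have : r = r' := mul_right_cancel₀ (by exact_mod_cast (by lia : q ≠ 0)) (sub_eq_zero.1 h)
      exact hne (by rw [this])
    have h2 : (1 : ℝ) ≤ |((r * (q : ℤ) - r' * q : ℤ) : ℝ)| := by exact_mod_cast Int.one_le_abs h1
    refine le_trans ?_ h2
    exact mul_le_one₀ hc1 (by positivity)
      (Real.rpow_le_one_of_one_le_of_nonpos hmax (by linarith))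
  · set m : ℕ := ((n : ℤ) - q).natAbs with hm
    have hmpos : 1 ≤ m := by lia
    have hm0 : (0 : ℝ) < m := by exact_mod_cast hmpos
    have hmle : (m : ℝ) ≤ max (q : ℝ) n := by
      have : m ≤ max q n := by lia
      exact_mod_cast this
    obtain ⟨p, hp⟩ : ∃ p : ℤ, |((r * n - r' * q : ℤ) : ℝ) - θ * ((n : ℝ) - q)| =
        |p - θ * m| := by
      rcases Int.natAbs_eq ((n : ℤ) - q) with h | h
      · refine ⟨r * n - r' * q, ?_⟩
        have : ((n : ℝ) - q) = m := by
          have := congrArg (fun z : ℤ => (z : ℝ)) (show (n : ℤ) - q = (m : ℤ) from h)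
          simpa only [Int.cast_sub, Int.cast_natCast] using this
        rw [this]
      · refine ⟨-(r * n - r' * q), ?_⟩
        have : ((n : ℝ) - q) = -m := by
          have := congrArg (fun z : ℤ => (z : ℝ)) (show (n : ℤ) - q = -(m : ℤ) from h)
          simpa only [Int.cast_sub, Int.cast_neg, Int.cast_natCast] using this
        rw [this, ← abs_neg]
        congr 1
        push_cast
        ring
    rw [hp]
    have h3 := hcθ p m hmpos
    have h4 : |(p : ℝ) - θ * m| = m * |θ - p / m| := by
      have : (p : ℝ) - θ * m = -(m * (θ - p / m)) := by field_simp; ring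
      rw [this, abs_neg, abs_mul, abs_of_pos hm0]
    rw [h4]
    calc c * (max (q : ℝ) n) ^ (1 - g) ≤ c * (m : ℝ) ^ (1 - g) := by
          gcongr ?_ * ?_
          exact Real.rpow_le_rpow_of_nonpos hm0 hmle (by linarith)
      _ = m * (c * (m : ℝ) ^ (-g)) := by
          rw [sub_eq_add_neg, Real.rpow_add hm0, Real.rpow_one]; ring
      _ ≤ _ := by gcongr

lemma finite_approxPairs_of_bounded (f : ℕ → ℝ) (θ x : ℝ) (n₀ : ℕ)
    (h : ∀ p ∈ approxPairs f θ x, p.2 < n₀) : (approxPairs f θ x).Finite := by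
  have hsub : approxPairs f θ x ⊆ ⋃ n ∈ Finset.range n₀,
      (fun r : ℤ => (r, n)) '' (Set.Icc ⌊n * (x - f n) + θ⌋ ⌈n * (x + f n) + θ⌉) := by
    rintro ⟨r, n⟩ hp
    have hn := h _ hp
    obtain ⟨hn1, -, habs⟩ := hp
    simp only at hn hn1 habs
    have hn0 : (0 : ℝ) < n := by exact_mod_cast hn1
    simp only [Set.mem_iUnion, Finset.mem_range]
    refine ⟨n, hn, r, ?_, rfl⟩
    rw [abs_le] at habs
    have h1 : ((r : ℝ) - θ) / n ≤ x + f n := by linarith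
    have h2 : x - f n ≤ ((r : ℝ) - θ) / n := by linarith
    rw [div_le_iff₀ hn0] at h1
    rw [le_div_iff₀ hn0] at h2
    constructor
    · have : (⌊n * (x - f n) + θ⌋ : ℝ) ≤ r := (Int.floor_le _).trans (by linarith)
      exact_mod_cast this
    · have : (r : ℝ) ≤ ⌈n * (x + f n) + θ⌉ := le_trans (by linarith) (Int.le_ceil _)
      exact_mod_cast this
  exact Set.Finite.subset (Set.Finite.biUnion (Finset.finite_toSet _)
    fun n _ => (Set.finite_Icc _ _).image _) hsub

/-- A number with a sequence of nearly exact approximations, whose denominators do not grow too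
fast, is approximable to exact order `ψ`. -/
theorem mem_Exact_of_sequence {θ g c τ' b x : ℝ} {ψ : ℕ → ℝ} (hg : 1 ≤ g) (hc : 0 < c)
    (hsep : Separated θ g c) (hψ_pos : ∀ q : ℕ, 1 ≤ q → 0 < ψ q)
    (hψ_dec : ∀ q q' : ℕ, 1 ≤ q → q ≤ q' → ψ q' ≤ ψ q)
    (hψ : ∀ᶠ q : ℕ in atTop, ψ q ≤ (q : ℝ) ^ (-τ')) (hτ' : 1 < τ')
    (hb : b < ((τ' - 1) / g) ^ 2) {q : ℕ → ℕ} {r : ℕ → ℤ} {e : ℕ → ℝ} (hq1 : ∀ k, 1 ≤ q k)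
    (hq : Tendsto q atTop atTop) (hqb : ∀ k, (q (k + 1) : ℝ) ≤ (q k : ℝ) ^ b)
    (hcop : ∀ k, IsCoprime (r k) (q k : ℤ)) (he : Tendsto e atTop (𝓝 0))
    (hlow : ∀ k, (1 - e k) * ψ (q k) ≤ x - ((r k : ℝ) - θ) / q k)
    (hup : ∀ k, |x - ((r k : ℝ) - θ) / q k| ≤ ψ (q k)) :
    x ∈ Exact ψ θ := by
  refine ⟨?_, fun c' hc' => ?_⟩
  · intro hfin
    have h1 : (Prod.snd '' approxPairs ψ θ x).Finite := hfin.image _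
    obtain ⟨N, hN⟩ := h1.bddAbove
    obtain ⟨k, hk⟩ := (hq.eventually (eventually_gt_atTop N)).exists
    have := hN ⟨(r k, q k), ⟨hq1 k, hcop k, hup k⟩, rfl⟩
    simp only at this
    lia
  have hg0 : 0 < g := by linarith
  set a := (τ' - 1) / g with ha
  have ha0 : 0 < a := div_pos (by linarith) hg0
  have hag : a * g = τ' - 1 := by rw [ha]; field_simp
  -- The margin by which consecutive forbidden windows overlap; its positivity is the hypothesis on
  -- `b`.
  set s := (τ' - 1) * a - b * g with hs
  have hs0 : 0 < s := by
    have : b * g < a ^ 2 * g := by gcongr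
    rw [hs, ← hag]
    nlinarith
  have hqR : Tendsto (fun k => (q k : ℝ)) atTop atTop := tendsto_natCast_atTop_atTop.comp hq
  obtain ⟨n₁, hn₁⟩ := eventually_atTop.1 hψ
  have hk₀ : ∀ᶠ k in atTop, e k < c' ∧ n₁ ≤ q k ∧ (c / 2) ^ (-(1 + a)) < (q k : ℝ) ^ s :=
    (he.eventually (gt_mem_nhds hc')).and ((hq.eventually (eventually_ge_atTop n₁)).and
      (((tendsto_rpow_atTop hs0).comp hqR).eventually (eventually_gt_atTop _)))
  obtain ⟨k₀, hk₀⟩ := eventually_atTop.1 hk₀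
  have hnR : Tendsto (fun n : ℕ => (n : ℝ) ^ g) atTop atTop :=
    (tendsto_rpow_atTop hg0).comp tendsto_natCast_atTop_atTop
  have hn₀ : ∀ᶠ n : ℕ in atTop, n₁ ≤ n ∧
      ∀ k ∈ Finset.range (k₀ + 1), c / 2 * (q k : ℝ) ^ (τ' - 1) ≤ (n : ℝ) ^ g :=
    (eventually_ge_atTop n₁).and
      ((Finset.eventually_all _).2 fun k _ => hnR.eventually (eventually_ge_atTop _))
  obtain ⟨n₀, hn₀⟩ := eventually_atTop.1 hn₀
  refine finite_approxPairs_of_bounded _ _ _ n₀ ?_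
  rintro ⟨r', n⟩ ⟨hn1, hcop', habs⟩
  simp only at hn1 hcop' habs ⊢
  by_contra! hnn
  obtain ⟨hn₁n, hnk⟩ := hn₀ n hnn
  -- The first such `k` puts `n` below the top of the window of `q k`, while minimality puts it
  -- above that of the preceding `q l`. The choice of `n₀` forces `k > k₀`.
  have hex : ∃ k, (n : ℝ) ^ g < c / 2 * (q k : ℝ) ^ (τ' - 1) := by
    have : Tendsto (fun k => c / 2 * (q k : ℝ) ^ (τ' - 1)) atTop atTop :=
      ((tendsto_rpow_atTop (by linarith)).comp hqR).const_mul_atTop (by positivity)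
    exact (this.eventually (eventually_gt_atTop _)).exists
  classical
  have hk := Nat.find_spec hex
  have hkmin := fun m => Nat.find_min hex (m := m)
  set k := Nat.find hex
  have hkk : k₀ < k := by
    by_contra! h
    exact absurd hk (not_lt.2 (hnk k (Finset.mem_range.2 (by lia))))
  obtain ⟨l, hl⟩ : ∃ l, k = l + 1 := ⟨k - 1, by lia⟩
  have hlmin := not_lt.1 (hkmin l (by lia))
  obtain ⟨hek, hqk, -⟩ := hk₀ k hkk.le
  obtain ⟨-, -, hql⟩ := hk₀ l (by lia)
  have hQ0 : (0 : ℝ) < q k := by exact_mod_cast hq1 k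
  have hQl0 : (0 : ℝ) < q l := by exact_mod_cast hq1 l
  have hN0 : (0 : ℝ) < n := by exact_mod_cast hn1
  have hψk := hψ_pos _ (hq1 k)
  have hψn := hψ_pos n hn1
  -- The constructed pair itself is excluded by `hlow`, as `e k < c'`.
  by_cases heq : (r k, q k) = (r', n)
  · obtain ⟨h1, h2⟩ := Prod.mk.injEq .. ▸ heq
    rw [← h1, ← h2] at habs
    have := (hlow k).trans ((le_abs_self _).trans habs)
    nlinarith
  have hsepk := hsep (r k) r' (q k) n (hq1 k) hn1 (hcop k) hcop' heq
  have htri : |((r k : ℝ) - θ) / q k - ((r' : ℝ) - θ) / n| ≤ ψ (q k) + ψ n := by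
    have h1 := abs_sub_le (((r k : ℝ) - θ) / q k) x (((r' : ℝ) - θ) / n)
    rw [abs_sub_comm _ x] at h1
    have : 0 < c' * ψ n := by positivity
    linarith [hup k]
  have hsum := hsepk.trans htri
  -- If `n ≥ q k`, repulsion contradicts the choice of `k`. If `n ≤ q k`, it gives `c / 2 * n ^ (τ'
  -- - 1) ≤ q k ^ g ≤ q l ^ (b * g)`; but raising the bound at `l` to the power `a` makes `n ^ (τ' -
  -- 1)` larger by about `q l ^ s`.
  rcases le_total (q k) n with hle | hle
  · have hle' : (q k : ℝ) ≤ n := by exact_mod_cast hle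
    rw [max_eq_right hle', div_le_iff₀ (by positivity)] at hsum
    have h1 := hψ_dec _ _ (hq1 k) hle
    have h2 := hn₁ _ hqk
    have h3 : (n : ℝ) * (n : ℝ) ^ (g - 1) = (n : ℝ) ^ g := by
      rw [← Real.rpow_one_add' hN0.le (by linarith)]; ring_nf
    have h4 : (q k : ℝ) ^ (-τ') * q k * (q k : ℝ) ^ (τ' - 1) = 1 := by
      rw [← Real.rpow_add_one hQ0.ne', ← Real.rpow_add hQ0]; ring_nf; exact Real.rpow_zero _
    have h5 : c ≤ 2 * (q k : ℝ) ^ (-τ') * q k * (n : ℝ) ^ g := by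
      calc c ≤ _ := hsum
        _ ≤ (2 * (q k : ℝ) ^ (-τ')) * (q k * n * (n : ℝ) ^ (g - 1)) := by
            gcongr; linarith
        _ = 2 * (q k : ℝ) ^ (-τ') * q k * (n * (n : ℝ) ^ (g - 1)) := by ring
        _ = _ := by rw [h3]
    have h6 : 2 * (q k : ℝ) ^ (-τ') * q k * (n : ℝ) ^ g <
        2 * (q k : ℝ) ^ (-τ') * q k * (c / 2 * (q k : ℝ) ^ (τ' - 1)) := by gcongr
    have h7 : 2 * (q k : ℝ) ^ (-τ') * q k * (c / 2 * (q k : ℝ) ^ (τ' - 1)) = c := by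
      calc _ = c * ((q k : ℝ) ^ (-τ') * q k * (q k : ℝ) ^ (τ' - 1)) := by ring
        _ = c := by rw [h4, mul_one]
    linarith
  · have hle' : (n : ℝ) ≤ q k := by exact_mod_cast hle
    rw [max_eq_left hle', div_le_iff₀ (by positivity)] at hsum
    have h1 := hψ_dec _ _ hn1 hle
    have h2 := hn₁ _ hn₁n
    have h3 : (q k : ℝ) * (q k : ℝ) ^ (g - 1) = (q k : ℝ) ^ g := by
      rw [← Real.rpow_one_add' hQ0.le (by linarith)]; ring_nf
    have h4 : (n : ℝ) ^ (-τ') * n * (n : ℝ) ^ (τ' - 1) = 1 := by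
      rw [← Real.rpow_add_one hN0.ne', ← Real.rpow_add hN0]; ring_nf; exact Real.rpow_zero _
    have h5 : c / 2 * (n : ℝ) ^ (τ' - 1) ≤ (q k : ℝ) ^ g := by
      have h6 : c ≤ 2 * (n : ℝ) ^ (-τ') * n * (q k : ℝ) ^ g := by
        calc c ≤ _ := hsum
          _ ≤ (2 * (n : ℝ) ^ (-τ')) * (q k * n * (q k : ℝ) ^ (g - 1)) := by
              gcongr; linarith
          _ = 2 * (n : ℝ) ^ (-τ') * n * (q k * (q k : ℝ) ^ (g - 1)) := by ring
          _ = _ := by rw [h3]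
      calc c / 2 * (n : ℝ) ^ (τ' - 1) ≤
            (2 * (n : ℝ) ^ (-τ') * n * (q k : ℝ) ^ g) / 2 * (n : ℝ) ^ (τ' - 1) := by gcongr
        _ = ((n : ℝ) ^ (-τ') * n * (n : ℝ) ^ (τ' - 1)) * (q k : ℝ) ^ g := by ring
        _ = _ := by rw [h4, one_mul]
    have h6 : (q k : ℝ) ^ g ≤ (q l : ℝ) ^ (b * g) := by
      rw [Real.rpow_mul hQl0.le]
      gcongr
      rw [hl]
      exact hqb l
    have h7 : (c / 2) ^ a * (q l : ℝ) ^ ((τ' - 1) * a) ≤ (n : ℝ) ^ (τ' - 1) := by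
      have h8 : (n : ℝ) ^ (τ' - 1) = ((n : ℝ) ^ g) ^ a := by
        rw [← Real.rpow_mul hN0.le, mul_comm g, hag]
      rw [h8, Real.rpow_mul hQl0.le, ← Real.mul_rpow (by positivity) (by positivity)]
      gcongr
    have h9 : (c / 2) ^ (1 + a) * (q l : ℝ) ^ ((τ' - 1) * a) ≤ (q l : ℝ) ^ (b * g) := by
      rw [Real.rpow_add (by positivity), Real.rpow_one, mul_assoc]
      refine le_trans ?_ (h5.trans h6)
      gcongr
    have h10 : (q l : ℝ) ^ ((τ' - 1) * a) = (q l : ℝ) ^ s * (q l : ℝ) ^ (b * g) := by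
      rw [← Real.rpow_add hQl0, hs]; ring_nf
    rw [h10, ← mul_assoc] at h9
    have h11 : (c / 2) ^ (1 + a) * (q l : ℝ) ^ s ≤ 1 := by
      by_contra! hcon
      have : (q l : ℝ) ^ (b * g) < (c / 2) ^ (1 + a) * (q l : ℝ) ^ s * (q l : ℝ) ^ (b * g) :=
        lt_mul_of_one_lt_left (by positivity) hcon
      linarith
    rw [Real.rpow_neg (by positivity), inv_lt_iff_one_lt_mul₀ (by positivity)] at hql
    linarith

/-! ### Weyl's criterion on the circle -/

lemma volume_singleton_unitAddCircle (z : UnitAddCircle) :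
    volume ({z} : Set UnitAddCircle) = 0 := by
  rw [← (UnitAddCircle.measurePreserving_mk 0).measure_preimage
    (measurableSet_singleton z).nullMeasurableSet]
  obtain ⟨y, rfl⟩ := QuotientAddGroup.mk_surjective z
  have hsub : ((↑) ⁻¹' {(y : UnitAddCircle)} : Set ℝ) ⊆ Set.range fun n : ℤ => y + n := by
    intro x hx
    have h1 : ((x - y : ℝ) : UnitAddCircle) = 0 := by
      rw [AddCircle.coe_sub, sub_eq_zero]
      exact hx
    obtain ⟨n, hn⟩ := (AddCircle.coe_eq_zero_iff 1).1 h1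
    exact ⟨n, by simp at hn; simp [hn]⟩
  exact ((Set.countable_range _).mono hsub).measure_zero _

lemma coe_mem_image_Ico_iff {a b : ℝ} (ha : 0 ≤ a) (hb : b ≤ 1) (u : ℝ) :
    (u : UnitAddCircle) ∈ ((↑) '' Set.Ico a b : Set UnitAddCircle) ↔ Int.fract u ∈ Set.Ico a b := by
  constructor
  · rintro ⟨y, hy, hyu⟩
    have h1 : ((y - u : ℝ) : UnitAddCircle) = 0 := by
      rw [AddCircle.coe_sub, sub_eq_zero]
      exact hyu
    obtain ⟨n, hn⟩ := (AddCircle.coe_eq_zero_iff 1).1 h1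
    have h2 : y = u + n := by simp at hn; linarith
    have h3 : Int.fract u = y := by
      rw [← Int.fract_add_intCast u n, ← h2]
      exact Int.fract_eq_self.2 ⟨ha.trans hy.1, hy.2.trans_le hb⟩
    rwa [h3]
  · exact fun h => ⟨Int.fract u, h, AddCircle.coe_fract u⟩

lemma measurableSet_image_Ico {a b : ℝ} (ha : 0 ≤ a) (hb : b ≤ 1) :
    MeasurableSet ((↑) '' Set.Ico a b : Set UnitAddCircle) := by
  have h : ((↑) '' Set.Ico a b : Set UnitAddCircle) =
      (fun z => (AddCircle.equivIco 1 0 z : ℝ)) ⁻¹' Set.Ico a b := by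
    ext z
    obtain ⟨y, rfl⟩ := QuotientAddGroup.mk_surjective z
    have := AddCircle.coe_equivIco_mk_apply (p := (1 : ℝ)) y
    rw [div_one, mul_one] at this
    rw [Set.mem_preimage, this]
    exact coe_mem_image_Ico_iff ha hb y
  rw [h]
  exact (measurable_subtype_coe.comp (AddCircle.measurableEquivIco 1 0).measurable)
    measurableSet_Ico

lemma volume_image_Ico {a b : ℝ} (ha : 0 ≤ a) (hb : b ≤ 1) :
    volume ((↑) '' Set.Ico a b : Set UnitAddCircle) = ENNReal.ofReal (b - a) := by
  have hmeas := measurableSet_image_Ico ha hb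
  rw [← (UnitAddCircle.measurePreserving_mk 0).measure_preimage hmeas.nullMeasurableSet,
    Measure.restrict_congr_set (Ioo_ae_eq_Ioc (α := ℝ) (μ := volume)).symm,
    Measure.restrict_congr_set (Ioo_ae_eq_Ico (α := ℝ) (μ := volume)),
    Measure.restrict_apply (hmeas.preimage AddCircle.measurable_mk'), ← Real.volume_Ico]
  congr 1
  ext y
  simp only [Set.mem_inter_iff, Set.mem_preimage, coe_mem_image_Ico_iff ha hb, zero_add]
  constructor
  · rintro ⟨h1, h2⟩
    rwa [Int.fract_eq_self.2 h2] at h1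
  · intro h
    have h2 : y ∈ Set.Ico (0 : ℝ) 1 := ⟨ha.trans h.1, h.2.trans_le hb⟩
    refine ⟨?_, h2⟩
    rwa [Int.fract_eq_self.2 h2]

lemma volume_frontier_image_Ico (a b : ℝ) :
    volume (frontier ((↑) '' Set.Ico a b : Set UnitAddCircle)) = 0 := by
  have hsub : frontier ((↑) '' Set.Ico a b : Set UnitAddCircle) ⊆
      {(a : UnitAddCircle), (b : UnitAddCircle)} := by
    intro z hz
    have hclosed : IsClosed ((↑) '' Set.Icc a b : Set UnitAddCircle) :=
      (isCompact_Icc.image (AddCircle.continuous_mk' 1)).isClosed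
    obtain ⟨y, hy, rfl⟩ := closure_minimal (Set.image_mono Set.Ico_subset_Icc_self) hclosed hz.1
    have hopen : IsOpen ((↑) '' Set.Ioo a b : Set UnitAddCircle) :=
      QuotientAddGroup.isOpenMap_coe _ isOpen_Ioo
    have h2 : y ∉ Set.Ioo a b := fun h =>
      hz.2 (interior_maximal (Set.image_mono Set.Ioo_subset_Ico_self) hopen ⟨y, h, rfl⟩)
    rcases hy.1.eq_or_lt with h | h
    · left; rw [h]
    · rcases hy.2.eq_or_lt with h' | h'
      · right; rw [h']; rfl
      · exact absurd ⟨h, h'⟩ h2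
  refine measure_mono_null hsub ?_
  rw [Set.insert_eq]
  exact measure_union_null (volume_singleton_unitAddCircle _) (volume_singleton_unitAddCircle _)

instance : IsProbabilityMeasure (volume : Measure UnitAddCircle) := ⟨UnitAddCircle.measure_univ⟩

lemma integral_fourier_unitAddCircle {h : ℤ} (hh : h ≠ 0) :
    ∫ z : UnitAddCircle, fourier h z = 0 := by
  rw [← UnitAddCircle.intervalIntegral_preimage 0]
  have hc : (2 * Real.pi * Complex.I * h : ℂ) ≠ 0 := by
    have := Complex.two_pi_I_ne_zero
    exact mul_ne_zero this (by exact_mod_cast hh)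
  have h1 : ∀ x : ℝ, fourier h (x : UnitAddCircle) =
      Complex.exp (2 * Real.pi * Complex.I * h * x) := by
    intro x
    rw [fourier_coe_apply]
    simp
  simp_rw [h1]
  rw [integral_exp_mul_complex hc]
  have h2 : Complex.exp (2 * Real.pi * Complex.I * h * ((0 + 1 : ℝ) : ℂ)) = 1 := by
    rw [Complex.exp_eq_one_iff]
    exact ⟨h, by push_cast; ring⟩
  rw [h2]
  simp

/-- The uniform probability measure on the first `N + 1` terms of a sequence. -/
noncomputable def empiricalMeasure (u : ℕ → UnitAddCircle) (N : ℕ) : Measure UnitAddCircle :=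
  ((N + 1 : ℕ) : ENNReal)⁻¹ • ∑ n ∈ Finset.range (N + 1), Measure.dirac (u n)

instance (u : ℕ → UnitAddCircle) (N : ℕ) : IsProbabilityMeasure (empiricalMeasure u N) := by
  refine ⟨?_⟩
  simp only [empiricalMeasure, Measure.smul_apply, Measure.finsetSum_apply, measure_univ,
    Finset.sum_const, Finset.card_range, smul_eq_mul, nsmul_eq_mul, mul_one]
  exact ENNReal.inv_mul_cancel (by simp) (by simp)

/-- The empirical measure as a bundled probability measure. -/
noncomputable def empiricalProbability (u : ℕ → UnitAddCircle) (N : ℕ) :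
    ProbabilityMeasure UnitAddCircle := ⟨empiricalMeasure u N, inferInstance⟩

/-- Lebesgue measure on the circle as a bundled probability measure. -/
noncomputable def circleProbability : ProbabilityMeasure UnitAddCircle := ⟨volume, inferInstance⟩

lemma integral_empiricalMeasure (u : ℕ → UnitAddCircle) (N : ℕ) (g : C(UnitAddCircle, ℂ)) :
    ∫ z, g z ∂(empiricalMeasure u N) =
      ((N + 1 : ℕ) : ℂ)⁻¹ * ∑ n ∈ Finset.range (N + 1), g (u n) := by
  rw [empiricalMeasure, integral_smul_measure, integral_finsetSum_measure]
  · simp only [integral_dirac]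
    rw [ENNReal.toReal_inv, ENNReal.toReal_natCast, Complex.real_smul]
    push_cast
    rfl
  · exact fun i _ => integrable_dirac (by simp)

/-- **Weyl's criterion**, in terms of weak convergence on the circle. -/
lemma tendsto_empiricalMeasure {u : ℕ → UnitAddCircle}
    (hu : ∀ h : ℤ, h ≠ 0 → Tendsto (fun N : ℕ =>
      ((N + 1 : ℕ) : ℂ)⁻¹ * ∑ n ∈ Finset.range (N + 1), fourier h (u n)) atTop (𝓝 0)) :
    Tendsto (empiricalProbability u) atTop (𝓝 circleProbability) := by
  refine ProbabilityMeasure.tendsto_of_tight_of_separatesPoints ℂ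
    IsTightMeasureSet.of_compactSpace
    (A := (fourierSubalgebra (T := 1)).comap (BoundedContinuousFunction.toContinuousMapStarₐ ℂ))
    ?_ ?_
  · intro x y hxy
    obtain ⟨_, ⟨f, hf, rfl⟩, hfxy⟩ := fourierSubalgebra_separatesPoints (T := 1) hxy
    exact ⟨f, ⟨f, ⟨BoundedContinuousFunction.mkOfCompact f, hf, rfl⟩, rfl⟩, hfxy⟩
  · intro g hg
    have hg' : g.toContinuousMap ∈ Submodule.span ℂ (Set.range (@fourier 1)) := by
      rw [← fourierSubalgebra_coe]
      exact hg
    change Tendsto (fun N => ∫ z, g.toContinuousMap z ∂(empiricalMeasure u N)) atTop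
      (𝓝 (∫ z, g.toContinuousMap z))
    generalize g.toContinuousMap = G at hg'
    have hint : ∀ (G : C(UnitAddCircle, ℂ)) (ν : Measure UnitAddCircle) [IsFiniteMeasure ν],
        Integrable G ν := fun G ν _ =>
      (BoundedContinuousFunction.mkOfCompact G).integrable ν
    induction hg' using Submodule.span_induction with
    | mem G hG =>
      obtain ⟨h, rfl⟩ := hG
      simp_rw [integral_empiricalMeasure]
      by_cases hh : h = 0
      · subst hh
        simp only [fourier_zero, Finset.sum_const, Finset.card_range, nsmul_eq_mul, mul_one,
          integral_const, probReal_univ, one_smul]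
        refine tendsto_const_nhds.congr fun N => ?_
        rw [inv_mul_cancel₀]
        exact_mod_cast Nat.succ_ne_zero N
      · rw [integral_fourier_unitAddCircle hh]
        exact hu h hh
    | zero => simp
    | add G H _ _ hG hH =>
      simp only [ContinuousMap.add_apply]
      rw [integral_add (hint _ _) (hint _ _)]
      refine (hG.add hH).congr fun N => ?_
      rw [integral_add (hint _ _) (hint _ _)]
    | smul c G _ hG =>
      simp only [ContinuousMap.smul_apply]
      rw [integral_smul]
      refine (hG.const_smul c).congr fun N => ?_
      rw [integral_smul]

/-- **Weyl's criterion** for uniform distribution modulo one. -/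
theorem equidistributedModOne_of_weyl {u : ℕ → ℝ}
    (hu : ∀ h : ℤ, h ≠ 0 → Tendsto (fun N : ℕ =>
      (N : ℂ)⁻¹ * ∑ n ∈ Finset.range N, fourier h (u n : UnitAddCircle)) atTop (𝓝 0)) :
    EquidistributedModOne u := by
  intro a b ha hab hb
  have hlim := tendsto_empiricalMeasure (u := fun n => (u n : UnitAddCircle))
    fun h hh => (tendsto_add_atTop_iff_nat 1).2 (hu h hh)
  obtain ⟨I, hI⟩ : ∃ I : Set UnitAddCircle, I = (↑) '' Set.Ico a b := ⟨_, rfl⟩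
  have hfront : (circleProbability : Measure UnitAddCircle) (frontier I) = 0 := by
    rw [hI]
    exact volume_frontier_image_Ico a b
  have hset := ProbabilityMeasure.tendsto_measure_of_null_frontier_of_tendsto' hlim hfront
  -- Empirical measures use `N + 1` terms so that none is an empty average.
  rw [← tendsto_add_atTop_iff_nat 1]
  have hvol : ((circleProbability : Measure UnitAddCircle) I).toReal = b - a := by
    change (volume I).toReal = b - a
    rw [hI, volume_image_Ico ha hb, ENNReal.toReal_ofReal (by linarith)]
  have hreal := (ENNReal.tendsto_toReal (measure_ne_top _ _)).comp hset
  rw [hvol] at hreal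
  refine hreal.congr fun N => ?_
  classical
  have hcard : Nat.card {n : ℕ // n < N + 1 ∧ Int.fract (u n) ∈ Set.Ico a b} =
      ((Finset.range (N + 1)).filter fun n => Int.fract (u n) ∈ Set.Ico a b).card := by
    rw [Nat.subtype_card]
    simp
  have hmeas : MeasurableSet I := hI ▸ measurableSet_image_Ico ha hb
  rw [hcard]
  simp only [Function.comp, empiricalProbability, ProbabilityMeasure.coe_mk, empiricalMeasure,
    Measure.smul_apply, Measure.finsetSum_apply, smul_eq_mul]
  have : ∀ n, Measure.dirac (u n : UnitAddCircle) I =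
      if Int.fract (u n) ∈ Set.Ico a b then 1 else 0 := by
    intro n
    rw [Measure.dirac_apply' _ hmeas, Set.indicator_apply]
    simp only [hI, coe_mem_image_Ico_iff ha hb, Pi.one_apply]
  simp_rw [this]
  rw [Finset.sum_boole, ENNReal.toReal_mul, ENNReal.toReal_inv, ENNReal.toReal_natCast,
    ENNReal.toReal_natCast, div_eq_inv_mul]

/-! ### Fourier decay and normal numbers -/

/-- The exponential sum of the orbit `b ^ n * x`, `n < N`, at the frequency `h`. -/
noncomputable def weylSum (b : ℕ) (h : ℤ) (N : ℕ) (x : ℝ) : ℂ :=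
  ∑ n ∈ Finset.range N, fourier h (((b : ℝ) ^ n * x : ℝ) : UnitAddCircle)

lemma continuous_weylSum (b : ℕ) (h : ℤ) (N : ℕ) : Continuous (weylSum b h N) := by
  refine continuous_finsetSum _ fun n _ => ?_
  exact (map_continuous (fourier h)).comp ((AddCircle.continuous_mk' 1).comp (by fun_prop))

lemma norm_weylSum_sub_le (b : ℕ) (h : ℤ) {M N : ℕ} (hMN : M ≤ N) (x : ℝ) :
    ‖weylSum b h N x - weylSum b h M x‖ ≤ N - M := by
  rw [weylSum, weylSum, ← Finset.sum_Ico_eq_sub _ hMN]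
  refine (norm_sum_le _ _).trans ?_
  have : ∀ n, ‖fourier h (((b : ℝ) ^ n * x : ℝ) : UnitAddCircle)‖ = 1 :=
    fun n => (AddCircle.toCircle _).norm_coe
  simp only [this, Finset.sum_const, Nat.card_Ico, nsmul_eq_mul, mul_one]
  rw [Nat.cast_sub hMN]

/-- The larger power dominates, and its exponent is at least the mean of `m` and `n`. The symmetric
form makes the off-diagonal double sum a product of geometric series. -/
lemma two_rpow_le_abs_pow_sub_pow {b : ℕ} (hb : 2 ≤ b) {m n : ℕ} (hmn : m ≠ n) :
    (2 : ℝ) ^ (((m : ℝ) + n) / 2 - 1) ≤ |(b : ℝ) ^ n - (b : ℝ) ^ m| := by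
  wlog h : m < n generalizing m n
  · have := this hmn.symm (lt_of_le_of_ne (not_lt.1 h) hmn.symm)
    rwa [abs_sub_comm, add_comm (m : ℝ)]
  have hb' : (2 : ℝ) ≤ b := by exact_mod_cast hb
  have h1 : 2 * (b : ℝ) ^ m ≤ (b : ℝ) ^ n := by
    calc 2 * (b : ℝ) ^ m ≤ b * (b : ℝ) ^ m := by gcongr
      _ = (b : ℝ) ^ (m + 1) := by ring
      _ ≤ _ := pow_le_pow_right₀ (by linarith) h
  have h2 : (2 : ℝ) ^ n ≤ (b : ℝ) ^ n := by gcongr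
  have hmn' : (m : ℝ) ≤ n := by exact_mod_cast h.le
  have h3 : (2 : ℝ) ^ (((m : ℝ) + n) / 2 - 1) ≤ (2 : ℝ) ^ ((n : ℝ) - 1) :=
    Real.rpow_le_rpow_of_exponent_le (by norm_num) (by linarith)
  rw [Real.rpow_sub (by norm_num) (n : ℝ), Real.rpow_natCast, Real.rpow_one] at h3
  have h4 : 0 ≤ (b : ℝ) ^ m := by positivity
  rw [abs_of_nonneg (by linarith)]
  linarith

lemma integral_fourier_mul_star (μ : Measure ℝ) (h : ℤ) (s t : ℝ) :
    ∫ x, fourier h ((s * x : ℝ) : UnitAddCircle) *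
      (starRingEnd ℂ) (fourier h ((t * x : ℝ) : UnitAddCircle)) ∂μ =
      fourierMeasure μ (h * (t - s)) := by
  unfold fourierMeasure
  refine integral_congr_ae (Eventually.of_forall fun x => ?_)
  simp only
  rw [← fourier_neg, fourier_coe_apply, fourier_coe_apply, ← Complex.exp_add]
  congr 1
  push_cast
  ring

/-- Expanding the square gives `N` from the diagonal; the rest are values of the transform at `h *
(b ^ n - b ^ m)`, absolutely summable over all pairs. -/
lemma exists_integral_norm_weylSum_sq_le {μ : Measure ℝ} [IsProbabilityMeasure μ] {C σ : ℝ}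
    (hσ : 0 < σ) (hμ : ∀ ξ : ℝ, ξ ≠ 0 → ‖fourierMeasure μ ξ‖ ≤ C * |ξ| ^ (-σ)) {b : ℕ}
    (hb : 2 ≤ b) {h : ℤ} (hh : h ≠ 0) :
    ∃ D : ℝ, 0 ≤ D ∧ ∀ N : ℕ, ∫ x, ‖weylSum b h N x‖ ^ 2 ∂μ ≤ N + D := by
  have hC : 0 ≤ C := by
    have := (norm_nonneg _).trans (hμ 1 one_ne_zero)
    simpa using this
  set ρ : ℝ := (2 : ℝ) ^ (-(σ / 2)) with hρ
  have hρ0 : 0 < ρ := by positivity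
  have hρ1 : ρ < 1 := Real.rpow_lt_one_of_one_lt_of_neg (by norm_num) (by linarith)
  have hoff : ∀ m n : ℕ, m ≠ n →
      ‖fourierMeasure μ (h * ((b : ℝ) ^ n - (b : ℝ) ^ m))‖ ≤ C * 2 ^ σ * (ρ ^ m * ρ ^ n) := by
    intro m n hmn
    have h1 := two_rpow_le_abs_pow_sub_pow hb hmn
    have h2 : (0 : ℝ) < (2 : ℝ) ^ (((m : ℝ) + n) / 2 - 1) := by positivity
    have h3 : (1 : ℝ) ≤ |(h : ℝ)| := by exact_mod_cast Int.one_le_abs hh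
    have h4 : (2 : ℝ) ^ (((m : ℝ) + n) / 2 - 1) ≤ |h * ((b : ℝ) ^ n - (b : ℝ) ^ m)| := by
      rw [abs_mul]
      nlinarith
    refine (hμ _ (abs_pos.1 (h2.trans_le h4))).trans ?_
    rw [mul_assoc C]
    gcongr
    calc _ ≤ ((2 : ℝ) ^ (((m : ℝ) + n) / 2 - 1)) ^ (-σ) :=
          Real.rpow_le_rpow_of_nonpos h2 h4 (by linarith)
      _ = _ := by
          rw [hρ, ← Real.rpow_natCast, ← Real.rpow_natCast, ← Real.rpow_mul (by norm_num),
            ← Real.rpow_mul (by norm_num), ← Real.rpow_mul (by norm_num),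
            ← Real.rpow_add (by norm_num), ← Real.rpow_add (by norm_num)]
          congr 1
          ring
  refine ⟨C * 2 ^ σ * ((1 - ρ)⁻¹ * (1 - ρ)⁻¹), by
    have : 0 < 1 - ρ := by linarith
    positivity, fun N => ?_⟩
  have hgeom : ∑ m ∈ Finset.range N, ρ ^ m ≤ (1 - ρ)⁻¹ := by
    rw [← tsum_geometric_of_lt_one hρ0.le hρ1]
    exact (summable_geometric_of_lt_one hρ0.le hρ1).sum_le_tsum _ fun m _ => by positivity
  have hcont : ∀ m n : ℕ, Continuous fun x : ℝ =>
      fourier h (((b : ℝ) ^ m * x : ℝ) : UnitAddCircle) *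
        (starRingEnd ℂ) (fourier h (((b : ℝ) ^ n * x : ℝ) : UnitAddCircle)) := by
    intro m n
    have h1 : ∀ k : ℕ, Continuous fun x : ℝ =>
        fourier h (((b : ℝ) ^ k * x : ℝ) : UnitAddCircle) := fun k =>
      (map_continuous (fourier h)).comp ((AddCircle.continuous_mk' 1).comp (by fun_prop))
    exact (h1 m).mul (Complex.continuous_conj.comp (h1 n))
  have hint : ∀ m n : ℕ, Integrable (fun x : ℝ =>
      fourier h (((b : ℝ) ^ m * x : ℝ) : UnitAddCircle) *
        (starRingEnd ℂ) (fourier h (((b : ℝ) ^ n * x : ℝ) : UnitAddCircle))) μ := by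
    intro m n
    refine Integrable.of_bound (hcont m n).aestronglyMeasurable 1 (Eventually.of_forall fun x => ?_)
    rw [norm_mul, RCLike.norm_conj]
    have : ∀ k, ‖fourier h (((b : ℝ) ^ k * x : ℝ) : UnitAddCircle)‖ = 1 :=
      fun k => (AddCircle.toCircle _).norm_coe
    rw [this, this, one_mul]
  have hexp : ((∫ x, ‖weylSum b h N x‖ ^ 2 ∂μ : ℝ) : ℂ) =
      ∑ m ∈ Finset.range N, ∑ n ∈ Finset.range N,
        fourierMeasure μ (h * ((b : ℝ) ^ n - (b : ℝ) ^ m)) := by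
    rw [← integral_complex_ofReal]
    have : ∀ x, ((‖weylSum b h N x‖ ^ 2 : ℝ) : ℂ) = ∑ m ∈ Finset.range N, ∑ n ∈ Finset.range N,
        fourier h (((b : ℝ) ^ m * x : ℝ) : UnitAddCircle) *
        (starRingEnd ℂ) (fourier h (((b : ℝ) ^ n * x : ℝ) : UnitAddCircle)) := by
      intro x
      rw [Complex.ofReal_pow, ← Complex.mul_conj', weylSum, map_sum, Finset.sum_mul_sum]
    simp_rw [this]
    rw [integral_finsetSum _ fun m _ => integrable_finsetSum _ fun n _ => hint m n]
    refine Finset.sum_congr rfl fun m _ => ?_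
    rw [integral_finsetSum _ fun n _ => hint m n]
    refine Finset.sum_congr rfl fun n _ => ?_
    exact integral_fourier_mul_star μ h _ _
  have hnorm : ‖((∫ x, ‖weylSum b h N x‖ ^ 2 ∂μ : ℝ) : ℂ)‖ ≤
      ∑ m ∈ Finset.range N, ∑ n ∈ Finset.range N,
        ((if m = n then 1 else 0) + C * 2 ^ σ * (ρ ^ m * ρ ^ n)) := by
    rw [hexp]
    refine norm_sum_le_of_le _ fun m _ => norm_sum_le_of_le _ fun n _ => ?_
    split_ifs with hmn
    · subst hmn
      have : fourierMeasure μ (h * ((b : ℝ) ^ m - (b : ℝ) ^ m)) = 1 := by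
        simp [fourierMeasure]
      rw [this, norm_one]
      have : 0 ≤ C * 2 ^ σ * (ρ ^ m * ρ ^ m) := by positivity
      linarith
    · rw [zero_add]
      exact hoff m n hmn
  rw [Complex.norm_real] at hnorm
  refine ((le_abs_self _).trans hnorm).trans ?_
  simp_rw [Finset.sum_add_distrib]
  have hd : ∑ m ∈ Finset.range N, ∑ n ∈ Finset.range N, (if m = n then (1 : ℝ) else 0) = N := by
    rw [Finset.sum_congr rfl (g := fun _ => (1 : ℝ))]
    · simp
    · intro m hm
      simp [Finset.mem_range.1 hm]
  rw [hd]
  simp_rw [← Finset.mul_sum]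
  rw [← Finset.sum_mul]
  gcongr

/-- By Tonelli the sum of the `X k` is finite almost everywhere. -/
lemma ae_tendsto_zero_of_summable_integral {α : Type*} [MeasurableSpace α] {μ : Measure α}
    {X : ℕ → α → ℝ} (hX : ∀ k, Integrable (X k) μ) (hX0 : ∀ k x, 0 ≤ X k x) {v : ℕ → ℝ}
    (hv : Summable v) (hXv : ∀ k, ∫ x, X k x ∂μ ≤ v k) :
    ∀ᵐ x ∂μ, Tendsto (fun k => X k x) atTop (𝓝 0) := by
  have hv0 : ∀ k, 0 ≤ v k := fun k => (integral_nonneg (hX0 k)).trans (hXv k)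
  have hfin : ∫⁻ x, ∑' k, ENNReal.ofReal (X k x) ∂μ ≠ ⊤ := by
    rw [lintegral_tsum fun k => (hX k).aemeasurable.ennreal_ofReal]
    refine ne_top_of_le_ne_top (hv.tsum_ofReal_ne_top) (ENNReal.tsum_le_tsum fun k => ?_)
    rw [← ofReal_integral_eq_lintegral_ofReal (hX k) (Eventually.of_forall (hX0 k))]
    exact ENNReal.ofReal_le_ofReal (hXv k)
  filter_upwards [ae_lt_top' (AEMeasurable.tsum fun k =>
    (hX k).aemeasurable.ennreal_ofReal) hfin] with x hx
  have h1 := ENNReal.tendsto_atTop_zero_of_tsum_ne_top hx.ne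
  have h2 := (ENNReal.tendsto_toReal ENNReal.zero_ne_top).comp h1
  refine h2.congr fun k => ?_
  exact ENNReal.toReal_ofReal (hX0 k x)

/-- From `k ^ 2` to `N < (k + 1) ^ 2` there are at most `2 * k` further terms, negligible against `k
^ 2`. -/
lemma tendsto_div_of_tendsto_squares {S : ℕ → ℂ} (hS : ∀ M N : ℕ, M ≤ N → ‖S N - S M‖ ≤ N - M)
    (h : Tendsto (fun k : ℕ => ‖S (k ^ 2)‖ ^ 2 / (k : ℝ) ^ 4) atTop (𝓝 0)) :
    Tendsto (fun N : ℕ => (N : ℂ)⁻¹ * S N) atTop (𝓝 0) := by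
  have h1 : Tendsto (fun k : ℕ => ‖S (k ^ 2)‖ / (k : ℝ) ^ 2) atTop (𝓝 0) := by
    have := (Real.continuous_sqrt.tendsto 0).comp h
    rw [Real.sqrt_zero] at this
    refine this.congr fun k => ?_
    have e : ‖S (k ^ 2)‖ ^ 2 / (k : ℝ) ^ 4 = (‖S (k ^ 2)‖ / (k : ℝ) ^ 2) ^ 2 := by
      rw [div_pow]; ring_nf
    rw [Function.comp, e, Real.sqrt_sq (by positivity)]
  have h2 : Tendsto (fun k : ℕ => ‖S (k ^ 2)‖ / (k : ℝ) ^ 2 + 2 / k) atTop (𝓝 0) := by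
    simpa using h1.add (tendsto_const_div_atTop_nhds_zero_nat 2)
  have hsqrt : Tendsto Nat.sqrt atTop atTop := by
    refine tendsto_atTop_atTop.2 fun k => ⟨k ^ 2, fun N hN => ?_⟩
    exact Nat.le_sqrt'.2 hN
  rw [tendsto_zero_iff_norm_tendsto_zero]
  refine squeeze_zero' (Eventually.of_forall fun _ => norm_nonneg _) ?_ (h2.comp hsqrt)
  filter_upwards [eventually_ge_atTop 1] with N hN
  set k := Nat.sqrt N with hk
  have hkN : k ^ 2 ≤ N := Nat.sqrt_le' N
  have hNk : N ≤ k ^ 2 + 2 * k := by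
    have := Nat.sqrt_le_add N
    rw [← hk] at this
    nlinarith
  have hk1 : 1 ≤ k := Nat.le_sqrt'.2 (by simpa using hN)
  have hk0 : (0 : ℝ) < k := by exact_mod_cast hk1
  have hkN' : (k : ℝ) ^ 2 ≤ N := by exact_mod_cast hkN
  have hNk' : (N : ℝ) ≤ (k : ℝ) ^ 2 + 2 * k := by exact_mod_cast hNk
  have h3 : ‖S N‖ ≤ ‖S (k ^ 2)‖ + 2 * k := by
    have h4 := hS _ _ hkN
    have h5 := norm_le_norm_add_norm_sub (S (k ^ 2)) (S N)
    rw [norm_sub_rev] at h5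
    push_cast at h4
    linarith
  rw [norm_mul, norm_inv, Complex.norm_natCast]
  calc (N : ℝ)⁻¹ * ‖S N‖ ≤ ((k : ℝ) ^ 2)⁻¹ * (‖S (k ^ 2)‖ + 2 * k) := by gcongr
    _ = ‖S (k ^ 2)‖ / (k : ℝ) ^ 2 + 2 / k := by field_simp

/-- Almost every number is normal with respect to a measure with polynomial Fourier decay. -/
theorem ae_isNormalNumber {μ : Measure ℝ} [IsProbabilityMeasure μ] {C σ : ℝ} (hσ : 0 < σ)
    (hμ : ∀ ξ : ℝ, ξ ≠ 0 → ‖fourierMeasure μ ξ‖ ≤ C * |ξ| ^ (-σ)) :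
    ∀ᵐ x ∂μ, IsNormalNumber x := by
  -- Along the squares the normalized second moments are `O(1 / k ^ 2)`, hence summable, and there
  -- are only countably many `b` and `h`.
  have key : ∀ᵐ x ∂μ, ∀ (b : ℕ) (h : ℤ), 2 ≤ b → h ≠ 0 →
      Tendsto (fun k : ℕ => ‖weylSum b h (k ^ 2) x‖ ^ 2 / (k : ℝ) ^ 4) atTop (𝓝 0) := by
    rw [ae_all_iff]; intro b
    rw [ae_all_iff]; intro h
    by_cases hb : 2 ≤ b
    swap
    · exact Eventually.of_forall fun x hb' => absurd hb' hb
    by_cases hh : h = 0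
    · exact Eventually.of_forall fun x _ hh' => absurd hh hh'
    obtain ⟨D, hD, hDN⟩ := exists_integral_norm_weylSum_sq_le hσ hμ hb hh
    have hlim := ae_tendsto_zero_of_summable_integral (μ := μ)
      (X := fun k x => ‖weylSum b h (k ^ 2) x‖ ^ 2 / (k : ℝ) ^ 4)
      (v := fun k : ℕ => (1 + D) * (1 / (k : ℝ) ^ 2)) (fun k => ?_) (fun k x => by positivity)
      ((Real.summable_one_div_nat_pow.2 one_lt_two).mul_left _) (fun k => ?_)
    · filter_upwards [hlim] with x hx _ _ using hx
    · have hc : Continuous fun x => ‖weylSum b h (k ^ 2) x‖ ^ 2 / (k : ℝ) ^ 4 :=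
        ((continuous_weylSum b h (k ^ 2)).norm.pow 2).div_const _
      refine Integrable.of_bound hc.aestronglyMeasurable (((k ^ 2 : ℕ) : ℝ) ^ 2 / (k : ℝ) ^ 4)
        (Eventually.of_forall fun x => ?_)
      rw [Real.norm_of_nonneg (by positivity)]
      have := norm_weylSum_sub_le b h (Nat.zero_le (k ^ 2)) x
      simp only [weylSum, Finset.range_zero, Finset.sum_empty, sub_zero, Nat.cast_zero] at this
      gcongr
      exact this
    · rw [integral_div]
      rcases Nat.eq_zero_or_pos k with rfl | hk
      · simp
      have hk1 : (1 : ℝ) ≤ (k : ℝ) ^ 2 := one_le_pow₀ (by exact_mod_cast hk)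
      rw [div_le_iff₀ (by positivity)]
      calc _ ≤ _ := hDN (k ^ 2)
        _ = (k : ℝ) ^ 2 + D := by push_cast; rfl
        _ ≤ (1 + D) * (k : ℝ) ^ 2 := by nlinarith
        _ = _ := by
          have : (k : ℝ) ≠ 0 := by positivity
          field_simp
  filter_upwards [key] with x hx b hb
  refine equidistributedModOne_of_weyl fun h hh => ?_
  exact tendsto_div_of_tendsto_squares (S := fun N => weylSum b h N x)
    (fun M N hMN => norm_weylSum_sub_le b h hMN x) (hx b h hb hh)

/-! ### Primes, scales and the choice of parameters -/

/-- There are at least `M ^ (1 - ε)` primes between `M ^ (1 - ε)` and `M`. -/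
lemma eventually_exists_primes {ε : ℝ} (hε : 0 < ε) (hε1 : ε ≤ 1) :
    ∀ᶠ M : ℝ in atTop, ∃ P : Finset ℕ,
      (∀ q ∈ P, q.Prime ∧ M ^ (1 - ε) ≤ q ∧ (q : ℝ) ≤ M) ∧ M ^ (1 - ε) ≤ P.card := by
  have hlog := (isLittleO_log_rpow_atTop (half_pos hε)).bound one_pos
  have hbig := (tendsto_rpow_atTop (half_pos hε)).eventually (eventually_ge_atTop 14)
  filter_upwards [hlog, hbig, eventually_ge_atTop 2] with M hM hM14 hM2
  have hM0 : 0 < M := by linarith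
  have hM1 : 1 ≤ M := by linarith
  have hlogM0 : 0 < Real.log M := Real.log_pos (by linarith)
  have hlogM : Real.log M ≤ M ^ (ε / 2) := by
    rwa [one_mul, Real.norm_of_nonneg hlogM0.le, Real.norm_of_nonneg (by positivity)] at hM
  set Y := M ^ (1 - ε) with hY
  have hY1 : 1 ≤ Y := Real.one_le_rpow hM1 (by linarith)
  set W := M ^ (1 - ε / 2) with hW
  have hYW : Y * M ^ (ε / 2) = W := by rw [hY, hW, ← Real.rpow_add hM0]; ring_nf
  have hWM : W * M ^ (ε / 2) = M := by rw [hW, ← Real.rpow_add hM0]; ring_nf; simp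
  have hW1 : 1 ≤ W := Real.one_le_rpow hM1 (by linarith)
  have hpi := Chebyshev.pi_ge' (x := M) (by linarith)
  -- Chebyshev's bound leaves room to discard the primes below `Y`, of which there are fewer than `Y
  -- + 1`.
  have hcount : 2 * Y + 1 ≤ Nat.primeCounting ⌊M⌋₊ := by
    refine le_trans ?_ hpi
    rw [le_div_iff₀ hlogM0]
    have h1 : Real.log (M + 2) ≤ 2 * Real.log M := by
      rw [← Nat.cast_ofNat (R := ℝ), ← Real.log_pow]
      exact Real.log_le_log (by positivity) (by push_cast; nlinarith)
    have h2 : M ^ (ε / 2) ≤ W := Real.rpow_le_rpow_of_exponent_le hM1 (by linarith)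
    have h3 : (2 * Y + 1) * Real.log M ≤ 3 * W := by
      calc (2 * Y + 1) * Real.log M ≤ (3 * Y) * M ^ (ε / 2) := by
            gcongr
            linarith
        _ = 3 * W := by rw [mul_assoc, hYW]
    have h4 : 14 * W ≤ M := by
      calc 14 * W ≤ M ^ (ε / 2) * W := by gcongr
        _ = M := by rw [mul_comm, hWM]
    nlinarith [Real.log_two_gt_d9, Real.log_two_lt_d9]
  refine ⟨(Finset.range (⌊M⌋₊ + 1)).filter fun q => q.Prime ∧ Y ≤ q, fun q hq => ?_, ?_⟩
  · rw [Finset.mem_filter, Finset.mem_range] at hq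
    exact ⟨hq.2.1, hq.2.2, (Nat.le_floor_iff hM0.le).1 (by lia)⟩
  · have hsub : (Finset.range (⌊M⌋₊ + 1)).filter Nat.Prime ⊆
        ((Finset.range (⌊M⌋₊ + 1)).filter fun q => q.Prime ∧ Y ≤ q) ∪
          Finset.range ⌈Y⌉₊ := by
      intro q hq
      rw [Finset.mem_filter] at hq
      rw [Finset.mem_union, Finset.mem_filter, Finset.mem_range (n := ⌈Y⌉₊), Nat.lt_ceil]
      by_cases h : Y ≤ q
      · exact Or.inl ⟨hq.1, hq.2, h⟩
      · exact Or.inr (not_le.1 h)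
    have hcard := (Finset.card_le_card hsub).trans (Finset.card_union_le _ _)
    have hpc : ((Finset.range (⌊M⌋₊ + 1)).filter Nat.Prime).card = Nat.primeCounting ⌊M⌋₊ := by
      rw [Nat.primeCounting, Nat.primeCounting', Nat.count_eq_card_filter_range]
    rw [hpc, Finset.card_range] at hcard
    have hcard' : (Nat.primeCounting ⌊M⌋₊ : ℝ) ≤
        (((Finset.range (⌊M⌋₊ + 1)).filter fun q : ℕ => q.Prime ∧ Y ≤ q).card : ℝ) + ⌈Y⌉₊ := by
      exact_mod_cast hcard
    have := Nat.ceil_lt_add_one (zero_le_one.trans hY1)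
    linarith

/-- The threshold is the larger root of `τ ^ 2 - (2 + γ ^ 2) * τ + 1`, whose positivity is the
second claim; it amounts to `β > τ`. -/
lemma sq_gt_of_threshold {γ τ : ℝ} (hγ : 1 ≤ γ)
    (hτ : (2 + γ ^ 2 + Real.sqrt ((2 + γ ^ 2) ^ 2 - 4)) / 2 < τ) :
    2 < τ ∧ γ ^ 2 * τ < (τ - 1) ^ 2 := by
  have hs := Real.sqrt_nonneg ((2 + γ ^ 2) ^ 2 - 4)
  have hsq : Real.sqrt ((2 + γ ^ 2) ^ 2 - 4) ^ 2 = (2 + γ ^ 2) ^ 2 - 4 :=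
    Real.sq_sqrt (by nlinarith [sq_nonneg γ])
  have h1 : γ ^ 2 * τ < (τ - 1) ^ 2 := by nlinarith
  refine ⟨?_, h1⟩
  have hγ2 : 1 ≤ γ ^ 2 := one_le_pow₀ hγ
  by_contra! h
  nlinarith

/-- The scales of the construction: each is the `ρ`-th power of the preceding one. -/
noncomputable def scale (X ρ : ℝ) (k : ℕ) : ℝ := X ^ (ρ ^ k)

lemma scale_succ {X : ℝ} (hX : 0 < X) (ρ : ℝ) (k : ℕ) : scale X ρ (k + 1) = scale X ρ k ^ ρ := by
  rw [scale, scale, ← Real.rpow_mul hX.le, pow_succ]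

lemma le_scale {X ρ : ℝ} (hX : 1 ≤ X) (hρ : 1 ≤ ρ) (k : ℕ) : X ≤ scale X ρ k := by
  calc X = X ^ (1 : ℝ) := (Real.rpow_one X).symm
    _ ≤ _ := Real.rpow_le_rpow_of_exponent_le hX (one_le_pow₀ hρ)

lemma tendsto_scale {X ρ : ℝ} (hX : 1 < X) (hρ : 1 < ρ) : Tendsto (scale X ρ) atTop atTop :=
  (tendsto_rpow_atTop_of_base_gt_one X hX).comp (tendsto_pow_atTop_atTop_of_one_lt hρ)

/-- Bernoulli's inequality weakens the doubly exponential decay to the geometric decay that the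
kernel criterion asks for. -/
lemma scale_rpow_neg_le {X ρ E : ℝ} (hX : 1 ≤ X) (hρ : 1 < ρ) (hE : E < 0)
    (hX2 : X ^ (E * (ρ - 1)) ≤ 1 / 2) (k : ℕ) : scale X ρ (k + 1) ^ E ≤ X ^ E * (1 / 2) ^ k := by
  have hX0 : 0 < X := by linarith
  have hB : 1 + (ρ - 1) * k ≤ ρ ^ (k + 1) := by
    have := one_add_mul_le_pow (a := ρ - 1) (by linarith) (k + 1)
    push_cast at this
    rw [add_sub_cancel] at this
    nlinarith
  calc scale X ρ (k + 1) ^ E = X ^ (ρ ^ (k + 1) * E) := by rw [scale, ← Real.rpow_mul hX0.le]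
    _ ≤ X ^ (E + E * (ρ - 1) * k) := Real.rpow_le_rpow_of_exponent_le hX (by nlinarith)
    _ = X ^ E * (X ^ (E * (ρ - 1))) ^ k := by
        rw [Real.rpow_add hX0, Real.rpow_mul hX0.le, Real.rpow_natCast]
    _ ≤ _ := by gcongr

/-- At `ε = 0` the last expression is `(σ * τ * (β - 1) - (β - τ)) / β`, which is negative;
continuity does the rest. It is the power of the new scale that measures the cost of one kernel. -/
lemma exists_small_parameter {τ β σ : ℝ} (hβ : 1 < β) (h : σ * τ * (β - 1) < β - τ) :
    ∃ ε : ℝ, 0 < ε ∧ ε < 1 ∧ 1 < β * (1 - ε) ^ 2 ∧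
      -(1 - ε) + (τ + 2 * ε) * (1 - σ + ε) / (β * (1 - ε) ^ 2) + (τ + 2 * ε) * σ < 0 := by
  have hβ0 : β ≠ 0 := by linarith
  have c1 : ContinuousAt (fun ε : ℝ => β * (1 - ε) ^ 2) 0 := by fun_prop
  have c2 : ContinuousAt (fun ε : ℝ => -(1 - ε) + (τ + 2 * ε) * (1 - σ + ε) / (β * (1 - ε) ^ 2) +
      (τ + 2 * ε) * σ) 0 := by
    refine ContinuousAt.add (ContinuousAt.add (by fun_prop)
      (ContinuousAt.div (by fun_prop) (by fun_prop) (by simpa using hβ0))) (by fun_prop)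
  have e1 : ∀ᶠ ε : ℝ in 𝓝[>] 0, 1 < β * (1 - ε) ^ 2 :=
    (c1.eventually (lt_mem_nhds (by simpa using hβ))).filter_mono nhdsWithin_le_nhds
  have e2 : ∀ᶠ ε : ℝ in 𝓝[>] 0, -(1 - ε) + (τ + 2 * ε) * (1 - σ + ε) / (β * (1 - ε) ^ 2) +
      (τ + 2 * ε) * σ < 0 := by
    refine (c2.eventually (gt_mem_nhds ?_)).filter_mono nhdsWithin_le_nhds
    have hβ' : 0 < β := by linarith
    have : -(1 - (0 : ℝ)) + (τ + 2 * 0) * (1 - σ + 0) / (β * (1 - 0) ^ 2) + (τ + 2 * 0) * σ =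
        (σ * τ * (β - 1) - (β - τ)) / β := by field_simp; ring
    refine this.trans_lt ?_
    exact div_neg_of_neg_of_pos (by linarith) hβ'
  have e3 : ∀ᶠ ε : ℝ in 𝓝[>] 0, ε ∈ Set.Ioo (0 : ℝ) 1 := Ioo_mem_nhdsGT one_pos
  obtain ⟨ε, h1, h2, h3⟩ := (e1.and (e2.and e3)).exists
  exact ⟨ε, h3.1, h3.2, h1, h2⟩

/-- As the loss in `γ` and `τ` tends to 0, `((τ' - 1) / g) ^ 2` can be brought up to `β`. -/
lemma exists_separated_of_lt {θ γ τ b : ℝ}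
    (hγ : (θ = 0 ∧ γ = 1) ∨ (Irrational θ ∧ HasDiophantineExponent θ γ)) (hγ1 : 1 ≤ γ)
    (hτ : 1 < τ) (hb : b < (γ ^ 2)⁻¹ * (τ - 1) ^ 2) :
    ∃ g c τ' : ℝ, 1 ≤ g ∧ 0 < c ∧ 1 < τ' ∧ τ' < τ ∧ Separated θ g c ∧
      b < ((τ' - 1) / g) ^ 2 := by
  have hγ0 : γ ≠ 0 := by linarith
  have c1 : ContinuousAt (fun ε : ℝ => ((τ - ε - 1) / (γ + ε)) ^ 2) 0 := by
    refine ContinuousAt.pow (ContinuousAt.div (by fun_prop) (by fun_prop) (by simpa using hγ0)) 2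
  have e1 : ∀ᶠ ε : ℝ in 𝓝[>] 0, b < ((τ - ε - 1) / (γ + ε)) ^ 2 := by
    refine (c1.eventually (lt_mem_nhds ?_)).filter_mono nhdsWithin_le_nhds
    beta_reduce
    rw [sub_zero, add_zero, div_pow, div_eq_inv_mul]
    exact hb
  have e2 : ∀ᶠ ε : ℝ in 𝓝[>] 0, ε ∈ Set.Ioo (0 : ℝ) (τ - 1) := Ioo_mem_nhdsGT (by linarith)
  obtain ⟨ε, hbε, hε0, hε1⟩ := (e1.and e2).exists
  obtain ⟨g, c, hg1, hgε, hc, hsep⟩ : ∃ g c : ℝ, 1 ≤ g ∧ g < γ + ε ∧ 0 < c ∧ Separated θ g c := by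
    rcases hγ with ⟨rfl, rfl⟩ | ⟨hirr, hdio⟩
    · exact ⟨1, 1, le_rfl, by linarith, one_pos, separated_zero⟩
    · exact exists_separated_of_irrational hirr hdio hε0
  refine ⟨g, c, τ - ε, hg1, hc, by linarith, by linarith, hsep, hbε.trans_le ?_⟩
  have : 0 < τ - ε - 1 := by linarith
  have : 0 < g := by linarith
  gcongr

/-! ### Construction of the measure -/

/-- The set of numbers close to the right end of the interval of radius `ψ q` about a fraction
`(r - θ) / q` with `q ∈ P`. -/
def nearSet (ψ : ℕ → ℝ) (θ ε : ℝ) (P : Finset ℕ) : Set ℝ :=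
  {x | ∃ q ∈ P, ∃ r : ℤ, |x - ((r : ℝ) - θ) / q - (1 - (q : ℝ) ^ (-ε) / 2) * ψ q| ≤
    (q : ℝ) ^ (-ε) / 2 * ψ q}

lemma isClosed_nearSet (ψ : ℕ → ℝ) (θ ε : ℝ) {P : Finset ℕ} (hP : ∀ q ∈ P, q.Prime) :
    IsClosed (nearSet ψ θ ε P) := by
  have : nearSet ψ θ ε P = ⋃ q ∈ P, {x : ℝ | ∃ r : ℤ, |x - ((r : ℝ) - θ) / q -
      (1 - (q : ℝ) ^ (-ε) / 2) * ψ q| ≤ (q : ℝ) ^ (-ε) / 2 * ψ q} := by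
    ext x
    simp [nearSet]
  rw [this]
  exact P.finite_toSet.isClosed_biUnion
    fun q hq => isClosed_setOf_exists_int_near θ (hP q hq).pos _ _

/-- Away from the integers, the fractions `(r - θ) / q` that approximate a number are reduced. -/
lemma isCoprime_of_near {θ x y : ℝ} (hθ : θ ∈ Set.Ico (0 : ℝ) 1)
    (hx : x ∈ Set.Icc (1 / 4 : ℝ) (3 / 4)) {q : ℕ} (hq : q.Prime) (hq9 : 9 ≤ q) (hy : y ≤ (q : ℝ)⁻¹) {r : ℤ}
    (hr : |x - ((r : ℝ) - θ) / q| ≤ y) : IsCoprime r (q : ℤ) := by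
  rw [isCoprime_comm, Prime.coprime_iff_not_dvd (Nat.prime_iff_prime_int.1 hq)]
  -- If `q ∣ r` the shifted fraction is `m - θ / q`. The two errors total at most `2 / 9`, which is
  -- less than `1 / 4` because `q ≥ 9`, so `m` lies strictly between 0 and 1.
  rintro ⟨m, rfl⟩
  have hq9' : (9 : ℝ) ≤ q := by exact_mod_cast hq9
  have hq0 : (0 : ℝ) < q := by linarith
  have hinv : (q : ℝ)⁻¹ ≤ 9⁻¹ := by gcongr
  have h1 : (((q : ℤ) * m : ℤ) : ℝ) = q * m := by push_cast; rfl
  have h2 : ((q * m : ℝ) - θ) / q = m - θ / q := by field_simp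
  rw [h1, h2, abs_le] at hr
  have h3 : θ / q ≤ (q : ℝ)⁻¹ := by
    rw [div_eq_mul_inv]
    exact mul_le_of_le_one_left (by positivity) hθ.2.le
  have h4 : 0 ≤ θ / q := div_nonneg hθ.1 hq0.le
  have h5 : (0 : ℝ) < m := by linarith [hx.1]
  have h6 : (m : ℝ) < 1 := by linarith [hx.2]
  have h7 : 0 < m := by exact_mod_cast h5
  have h8 : m < 1 := by exact_mod_cast h6
  lia

/-- Of the loss `2 * ε`, one `ε` is the factor `q ^ (-ε)`, half of one covers the order of `ψ`, and
half of one the factor 2. -/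
lemma eventually_half_rpow_mul_ge {ψ : ℕ → ℝ} {τ ε : ℝ} (h : HasOrder ψ τ)
    (hψ : ∀ q : ℕ, 1 ≤ q → 0 < ψ q) (hε : 0 < ε) :
    ∀ᶠ q : ℕ in atTop, (q : ℝ) ^ (-(τ + 2 * ε)) ≤ (q : ℝ) ^ (-ε) / 2 * ψ q := by
  have h2 : ∀ᶠ q : ℕ in atTop, 2 ≤ (q : ℝ) ^ (ε / 2) :=
    ((tendsto_rpow_atTop (half_pos hε)).comp tendsto_natCast_atTop_atTop).eventually
      (eventually_ge_atTop 2)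
  filter_upwards [h.eventually_ge hψ (show τ < τ + ε / 2 by linarith), h2,
    eventually_ge_atTop 1] with q hq hq2 hq1
  have hq0 : (0 : ℝ) < q := by exact_mod_cast hq1
  have e1 : (q : ℝ) ^ (-ε) = (q : ℝ) ^ (-(3 / 2 * ε)) * (q : ℝ) ^ (ε / 2) := by
    rw [← Real.rpow_add hq0]; ring_nf
  have e2 : (q : ℝ) ^ (-(τ + 2 * ε)) = (q : ℝ) ^ (-(3 / 2 * ε)) * (q : ℝ) ^ (-(τ + ε / 2)) := by
    rw [← Real.rpow_add hq0]; ring_nf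
  rw [e1, e2]
  gcongr
  calc (q : ℝ) ^ (-(3 / 2 * ε)) ≤ (q : ℝ) ^ (-(3 / 2 * ε)) * ((q : ℝ) ^ (ε / 2) / 2) :=
        le_mul_of_one_le_right (by positivity) (by linarith)
    _ = _ := by ring

/-- Apply `mem_Exact_of_sequence` with `e k = q k ^ (-ε)` and `b = β * (1 - ε)`. Of the two factors
`1 - ε` in the growth exponent of the scales, one pays for the spread of the primes at one scale,
the other keeps `b` strictly below `β`. -/
lemma mem_Exact_of_mem_nearSet {θ γ τ β ε X x : ℝ} {ψ : ℕ → ℝ} (hθ : θ ∈ Set.Ico (0 : ℝ) 1)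
    (hγ : (θ = 0 ∧ γ = 1) ∨ (Irrational θ ∧ HasDiophantineExponent θ γ)) (hγ1 : 1 ≤ γ)
    (hψ_pos : ∀ q : ℕ, 1 ≤ q → 0 < ψ q)
    (hψ_dec : ∀ q q' : ℕ, 1 ≤ q → q ≤ q' → ψ q' ≤ ψ q)
    (hψ_order : HasOrder ψ τ) (hτ : 1 < τ) (hβ : β = (γ ^ 2)⁻¹ * (τ - 1) ^ 2)
    (hε0 : 0 < ε) (hε1 : ε < 1) (hρ : 1 < β * (1 - ε) ^ 2) (hX : 1 < X) (P : ℕ → Finset ℕ)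
    (hP : ∀ k, ∀ q ∈ P k, q.Prime ∧ scale X (β * (1 - ε) ^ 2) (k + 1) ^ (1 - ε) ≤ q ∧
      (q : ℝ) ≤ scale X (β * (1 - ε) ^ 2) (k + 1))
    (hP9 : ∀ k, ∀ q ∈ P k, 9 ≤ q ∧ ψ q ≤ (q : ℝ)⁻¹)
    (hx : x ∈ Set.Icc (1 / 4 : ℝ) (3 / 4)) (hxP : ∀ k, x ∈ nearSet ψ θ ε (P k)) :
    x ∈ Exact ψ θ := by
  set ρ := β * (1 - ε) ^ 2 with hρdef
  have hε1' : 0 < 1 - ε := by linarith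
  have hβ0 : 0 < β := by
    by_contra! h
    have : β * (1 - ε) ^ 2 ≤ 0 := mul_nonpos_of_nonpos_of_nonneg h (by positivity)
    linarith
  have hb : β * (1 - ε) < (γ ^ 2)⁻¹ * (τ - 1) ^ 2 := by
    rw [← hβ]
    nlinarith
  obtain ⟨g, c, τ', hg1, hc, hτ'1, hτ'τ, hsep, hbg⟩ := exists_separated_of_lt hγ hγ1 hτ hb
  choose q hqP r hr using hxP
  have hq1 : ∀ k, 1 ≤ q k := fun k => (hP k _ (hqP k)).1.pos
  have hqR : Tendsto (fun k => (q k : ℝ)) atTop atTop := by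
    refine tendsto_atTop_mono (fun k => (hP k _ (hqP k)).2.1) ?_
    exact (tendsto_rpow_atTop hε1').comp
      ((tendsto_add_atTop_iff_nat 1).2 (tendsto_scale hX hρ))
  have hpow : ∀ k, 0 < (q k : ℝ) ^ (-ε) ∧ (q k : ℝ) ^ (-ε) ≤ 1 := fun k => by
    have h1 : (1 : ℝ) ≤ q k := by exact_mod_cast hq1 k
    exact ⟨by positivity, Real.rpow_le_one_of_one_le_of_nonpos h1 (by linarith)⟩
  have hlow : ∀ k, (1 - (q k : ℝ) ^ (-ε)) * ψ (q k) ≤ x - ((r k : ℝ) - θ) / q k := by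
    intro k
    have := (abs_le.1 (hr k)).1
    linarith
  have hup : ∀ k, |x - ((r k : ℝ) - θ) / q k| ≤ ψ (q k) := by
    intro k
    rw [abs_le]
    have h1 := (abs_le.1 (hr k)).2
    have h2 := mul_nonneg (sub_nonneg.2 (hpow k).2) (hψ_pos _ (hq1 k)).le
    have h3 := hψ_pos _ (hq1 k)
    constructor
    · linarith [hlow k]
    · linarith
  refine mem_Exact_of_sequence hg1 hc hsep hψ_pos hψ_dec (hψ_order.eventually_le hψ_pos hτ'τ) hτ'1
    hbg hq1 (tendsto_natCast_atTop_iff.1 hqR) (fun k => ?_) (fun k => ?_)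
    ((tendsto_rpow_neg_atTop hε0).comp hqR) hlow hup
  · have hs0 : 0 < scale X ρ (k + 1) := Real.rpow_pos_of_pos (by linarith) _
    calc (q (k + 1) : ℝ) ≤ scale X ρ (k + 1 + 1) := (hP _ _ (hqP _)).2.2
      _ = (scale X ρ (k + 1) ^ (1 - ε)) ^ (β * (1 - ε)) := by
          rw [scale_succ (by linarith), ← Real.rpow_mul hs0.le, hρdef]
          ring_nf
      _ ≤ _ := by
          gcongr
          exact (hP _ _ (hqP _)).2.1
  · obtain ⟨h9, hψq⟩ := hP9 k _ (hqP k)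
    exact isCoprime_of_near hθ hx (hP k _ (hqP k)).1 h9 hψq (hup k)

/-- The set of exact order `ψ` carries measures with Fourier decay of every order `σ` with
`σ τ (β - 1) < β - τ`. -/
theorem exists_measure_on_Exact {θ γ τ β σ : ℝ} {ψ : ℕ → ℝ} (hθ : θ ∈ Set.Ico (0 : ℝ) 1)
    (hγ : (θ = 0 ∧ γ = 1) ∨ (Irrational θ ∧ HasDiophantineExponent θ γ)) (hγ1 : 1 ≤ γ)
    (hψ_pos : ∀ q : ℕ, 1 ≤ q → 0 < ψ q)
    (hψ_dec : ∀ q q' : ℕ, 1 ≤ q → q ≤ q' → ψ q' ≤ ψ q)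
    (hψ_order : HasOrder ψ τ) (hτ : 1 < τ) (hβ : β = (γ ^ 2)⁻¹ * (τ - 1) ^ 2) (hβ1 : 1 < β)
    (hσ0 : 0 ≤ σ) (hσ1 : σ ≤ 1) (hσ : σ * τ * (β - 1) < β - τ) :
    ∃ μ : Measure ℝ, IsProbabilityMeasure μ ∧
      (∃ K : Set ℝ, IsCompact K ∧ K ⊆ Exact ψ θ ∧ μ Kᶜ = 0) ∧
      ∃ C : ℝ, ∀ ξ : ℝ, ξ ≠ 0 → ‖fourierMeasure μ ξ‖ ≤ C * |ξ| ^ (-σ) := by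
  obtain ⟨ε, hε0, hε1, hρ, hE⟩ := exists_small_parameter hβ1 hσ
  set ρ := β * (1 - ε) ^ 2 with hρdef
  set τ₁ := τ + 2 * ε with hτ₁
  set E := -(1 - ε) + τ₁ * (1 - σ + ε) / ρ + τ₁ * σ with hEdef
  have hε1' : 0 < 1 - ε := by linarith
  have hτ₁0 : 0 < τ₁ := by linarith
  obtain ⟨κ, hκ, hmeasure⟩ := exists_measure_of_kernels hσ0 hσ1 hε0 hε1.le
  obtain ⟨C, hC, hkernel⟩ := exists_prime_kernel
  set A := τ₁ / (1 - ε) with hA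
  have hA0 : 0 ≤ A := by positivity
  have hψ1 : ∀ᶠ q : ℕ in atTop, (q : ℝ) ^ (-τ₁) ≤ (q : ℝ) ^ (-ε) / 2 * ψ q ∧ 9 ≤ q ∧
      ψ q ≤ (q : ℝ)⁻¹ := by
    filter_upwards [eventually_half_rpow_mul_ge hψ_order hψ_pos hε0, eventually_ge_atTop 9,
      hψ_order.eventually_le hψ_pos hτ] with q h1 h2 h3
    rw [Real.rpow_neg_one] at h3
    exact ⟨h1, h2, h3⟩
  obtain ⟨q₀, hq₀⟩ := eventually_atTop.1 hψ1
  obtain ⟨X₀, hX₀⟩ := eventually_atTop.1 ((eventually_exists_primes hε0 hε1.le).and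
    ((tendsto_rpow_atTop hε1').eventually (eventually_ge_atTop (max (Real.exp 1) q₀))))
  have hneg : ∀ {e : ℝ}, e < 0 → Tendsto (fun X : ℝ => X ^ e) atTop (𝓝 0) := fun {e} he => by
    have := tendsto_rpow_neg_atTop (neg_pos.2 he)
    rwa [neg_neg] at this
  obtain ⟨X, hX₀X, hX1, hXκ, hX2⟩ : ∃ X : ℝ, X₀ ≤ X ∧ 1 < X ∧ X ^ E ≤ κ / (C * (1 + A)) ∧
      X ^ (E * (ρ - 1)) ≤ 1 / 2 := by
    refine ((eventually_ge_atTop X₀).and ((eventually_gt_atTop 1).and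
      (((hneg hE).eventually (ge_mem_nhds (by positivity))).and
      ((hneg (mul_neg_of_neg_of_pos hE (by linarith))).eventually
        (ge_mem_nhds (by norm_num)))))).exists
  have hX0 : 0 < X := by linarith
  set M := scale X ρ with hM
  have hMX : ∀ k, X ≤ M k := fun k => le_scale hX1.le hρ.le k
  have hM1 : ∀ k, 1 ≤ M k := fun k => hX1.le.trans (hMX k)
  have hM0 : ∀ k, 0 < M k := fun k => zero_lt_one.trans_le (hM1 k)
  -- The `k`-th primes live at scale `M (k + 1)`: the kernel built from them refines frequency scale
  -- `M k ^ τ₁` to `M (k + 1) ^ τ₁`.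
  choose P hP hPcard using fun k => (hX₀ (M (k + 1)) (hX₀X.trans (hMX _))).1
  have hQ : ∀ k, max (Real.exp 1) q₀ ≤ M (k + 1) ^ (1 - ε) :=
    fun k => (hX₀ (M (k + 1)) (hX₀X.trans (hMX _))).2
  have hPq : ∀ k, ∀ q ∈ P k, q₀ ≤ q := fun k q hq => by
    have := ((le_max_right _ _).trans (hQ k)).trans (hP k q hq).2.1
    exact_mod_cast this
  have hMpos : ∀ k, 0 < M (k + 1) ^ (1 - ε) := fun k => Real.rpow_pos_of_pos (hM0 _) _
  have hcard0 : ∀ k, (0 : ℝ) < (P k).card := fun k => (hMpos k).trans_le (hPcard k)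
  have hmono : Monotone M := by
    refine monotone_nat_of_le_succ fun k => ?_
    rw [hM, scale_succ hX0]
    exact Real.self_le_rpow_of_one_le (hM1 k) hρ.le
  choose F c hFc hF0 hFs hc0 hcB hF using fun k => hkernel θ (P k) (M (k + 1) ^ (1 - ε))
    (M (k + 1) ^ τ₁) A (fun q => (1 - (q : ℝ) ^ (-ε) / 2) * ψ q)
    (fun q => (q : ℝ) ^ (-ε) / 2 * ψ q)
    (Finset.card_pos.1 (by exact_mod_cast hcard0 k))
    (fun q hq => ⟨(hP k q hq).1, (hP k q hq).2.1⟩)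
    ((le_max_left _ _).trans (hQ k)) (Real.one_le_rpow (hM1 _) hτ₁0.le) hA0
    (by
      rw [Real.log_rpow (hM0 _), Real.log_rpow (hM0 _), hA]
      apply le_of_eq
      field_simp)
    (fun q hq => by
      refine le_trans ?_ (hq₀ q (hPq k q hq)).1
      rw [← Real.rpow_neg (hM0 _).le]
      exact Real.rpow_le_rpow_of_nonpos (by exact_mod_cast (hP k q hq).1.pos) (hP k q hq).2.2
        (by linarith))
  obtain ⟨μ, hμ, hμI, hμZ, D, hD, hμD⟩ := hmeasure (fun k => M k ^ τ₁)
    (fun k => C * (1 + A) / (P k).card) F c (fun k => nearSet ψ θ ε (P k))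
    (Real.one_le_rpow (hM1 0) hτ₁0.le)
    (fun a b hab => Real.rpow_le_rpow (hM0 a).le (hmono hab) hτ₁0.le)
    (fun k => by positivity) hFc hF0
    (fun k => isClosed_nearSet ψ θ ε fun q hq => (hP k q hq).1)
    (fun k x hx => by
      by_contra h
      exact hx (hFs k x h))
    hc0 hcB hF (by
      intro k
      have hMk : M k = M (k + 1) ^ ρ⁻¹ := by
        rw [hM, scale_succ hX0, Real.rpow_rpow_inv (hM0 k).le (by linarith)]
      -- Everything is expressed through the new scale, using `M k = M (k + 1) ^ ρ⁻¹`; this is where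
      -- `E` comes from.
      have hexp : M (k + 1) ^ (-(1 - ε)) * (M k ^ τ₁) ^ (1 - σ + ε) * (M (k + 1) ^ τ₁) ^ σ =
          M (k + 1) ^ E := by
        rw [hMk, ← Real.rpow_mul (hM0 _).le, ← Real.rpow_mul (hM0 _).le,
          ← Real.rpow_mul (hM0 _).le, ← Real.rpow_add (hM0 _), ← Real.rpow_add (hM0 _), hEdef]
        congr 1
        field_simp
      calc C * (1 + A) / (P k).card * (M k ^ τ₁) ^ (1 - σ + ε) * (M (k + 1) ^ τ₁) ^ σ
          ≤ C * (1 + A) / M (k + 1) ^ (1 - ε) * (M k ^ τ₁) ^ (1 - σ + ε) *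
            (M (k + 1) ^ τ₁) ^ σ := by
            have h1 := Real.rpow_nonneg (Real.rpow_nonneg (hM0 k).le τ₁) (1 - σ + ε)
            have h2 := Real.rpow_nonneg (Real.rpow_nonneg (hM0 (k + 1)).le τ₁) σ
            have h3 := hMpos k
            gcongr
            exact hPcard k
        _ = C * (1 + A) * M (k + 1) ^ E := by
            rw [← hexp, Real.rpow_neg (hM0 _).le]
            ring
        _ ≤ C * (1 + A) * (κ / (C * (1 + A)) * (1 / 2) ^ k) := by
            gcongr
            exact (scale_rpow_neg_le hX1.le hρ hE hX2 k).trans (by gcongr)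
        _ = κ * (1 / 2) ^ k := by field_simp)
  refine ⟨μ, hμ, ⟨Set.Icc (1 / 4) (3 / 4) ∩ ⋂ k, nearSet ψ θ ε (P k), ?_, ?_, ?_⟩, D, ?_⟩
  · exact isCompact_Icc.inter_right
      (isClosed_iInter fun k => isClosed_nearSet ψ θ ε fun q hq => (hP k q hq).1)
  · rintro x ⟨hx, hxP⟩
    exact mem_Exact_of_mem_nearSet hθ hγ hγ1 hψ_pos hψ_dec hψ_order hτ hβ hε0 hε1 hρ hX1 P hP
      (fun k q hq => (hq₀ q (hPq k q hq)).2) hx (Set.mem_iInter.1 hxP)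
  · rw [Set.compl_inter, Set.compl_iInter]
    exact measure_union_null hμI (measure_iUnion_null hμZ)
  · intro ξ hξ
    refine (hμD ξ).trans ?_
    gcongr ?_ * ?_
    exact Real.rpow_le_rpow_of_nonpos (abs_pos.2 hξ) (by linarith) (by linarith)

end ExactOrder

theorem theorem1 (θ γ τ β α : ℝ) (ψ : ℕ → ℝ)
    (hθ : θ ∈ Set.Ico (0 : ℝ) 1)
    (hγ : (θ = 0 ∧ γ = 1) ∨ (Irrational θ ∧ ExactOrder.HasDiophantineExponent θ γ))
    (hψ_pos : ∀ q : ℕ, 1 ≤ q → 0 < ψ q)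
    (hψ_dec : ∀ q q' : ℕ, 1 ≤ q → q ≤ q' → ψ q' ≤ ψ q)
    (hψ_order : ExactOrder.HasOrder ψ τ)
    (hτ : (2 + γ ^ 2 + Real.sqrt ((2 + γ ^ 2) ^ 2 - 4)) / 2 < τ)
    (hβ : β = (γ ^ 2)⁻¹ * (τ - 1) ^ 2)
    (hα : α = 2 * (β - τ) / (τ * (β - 1))) :
    0 < α ∧ α ≤ ExactOrder.fourierDim (ExactOrder.Exact ψ θ) ∧
      ∃ x ∈ ExactOrder.Exact ψ θ, ExactOrder.IsNormalNumber x := by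
  have hγ1 : 1 ≤ γ := by
    rcases hγ with ⟨-, rfl⟩ | ⟨-, h⟩
    · exact le_rfl
    · exact h.one_le
  obtain ⟨hτ2, hτγ⟩ := ExactOrder.sq_gt_of_threshold hγ1 hτ
  have hβτ : τ < β := by
    rw [hβ, ← div_eq_inv_mul, lt_div_iff₀ (by positivity), mul_comm]
    exact hτγ
  have hden : 0 < τ * (β - 1) := mul_pos (by linarith) (by linarith)
  have hα0 : 0 < α := by
    rw [hα]
    exact div_pos (by linarith) hden
  -- Needed because the Fourier dimension is a supremum over exponents at most 1; it follows from `τ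
  -- > 2`.
  have hα1 : α ≤ 1 := by
    rw [hα, div_le_one hden]
    nlinarith
  -- With `σ = s / 2`, the condition `s < α` is exactly `σ * τ * (β - 1) < β - τ`.
  have hdecay : ∀ s, 0 ≤ s → s < α → ExactOrder.SupportsFourierDecay (ExactOrder.Exact ψ θ) s := by
    intro s hs0 hsα
    obtain ⟨μ, hμ, hK, C, hC⟩ := ExactOrder.exists_measure_on_Exact (σ := s / 2) hθ hγ hγ1 hψ_pos
      hψ_dec hψ_order (by linarith) hβ (by linarith) (by linarith) (by linarith) (by
        rw [hα, lt_div_iff₀ hden] at hsα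
        linarith)
    exact ⟨μ, hμ, hK, C, fun ξ hξ => by rw [neg_div]; exact hC ξ hξ⟩
  refine ⟨hα0, ?_, ?_⟩
  · refine le_of_forall_lt fun s hs => ?_
    obtain ⟨t, hst, htα⟩ := exists_between (max_lt hs hα0)
    refine ((le_max_left _ _).trans_lt hst).trans_le (le_csSup ⟨1, fun u hu => hu.2.1⟩ ?_)
    have ht0 : 0 ≤ t := (le_max_right s 0).trans hst.le
    exact ⟨ht0, htα.le.trans hα1, hdecay t ht0 htα⟩
  · obtain ⟨μ, hμ, ⟨K, -, hKE, hμK⟩, C, hC⟩ := hdecay (α / 2) (by linarith) (by linarith)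
    have hnormal := ExactOrder.ae_isNormalNumber (μ := μ) (C := C) (σ := α / 4) (by linarith)
      fun ξ hξ => by
        convert! hC ξ hξ using 3
        ring
    have hmem : ∀ᵐ x ∂μ, x ∈ K := by rwa [ae_iff]
    obtain ⟨x, hxK, hx⟩ := (hmem.and hnormal).exists
    exact ⟨x, hKE hxK, hx⟩
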